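/- Write $\mathcal H_d=\mathbb C^d$, $\tau_d=\mathbb 1/d$, $\|X\|_1=\mathrm{tr}\sqrt{X^\dagger X}$, $\|X\|_{HS}=\sqrt{\mathrm{tr}(X^\dagger X)}$, and $\mathrm{TV}(p,q)=\frac12\sum_i|p_i-q_i|$. A quantum channel on $\mathcal H_d$ is a completely positive trace-preserving linear map on operators on $\mathcal H_d$; its Choi–Jamiołkowski state is $\mathcal J_\Lambda=(\Lambda\otimes\mathrm{id})[|\Omega\rangle\langle\Omega|]$ with $\Omega=d^{-1/2}\sum_{i=1}^d|i\rangle\otimes|i\rangle$. A probability measure $\nu$ on the unitary group $U(\mathcal H_d)$ is a $\delta$-approximate $k$-design if $\|\mathcal T_{k,\nu}-\mathcal T_{k,\mu}\|_\diamond\le\delta$, where $\mu$ is the normalized Haar measure, $\mathcal T_{k,\nu}(X)=\int U^{\otimes k}X(U^\dagger)^{\otimes k}\,d\nu(U)$, and $\|\Phi\|_\diamond=\sup_{n}\sup_{\|X\|_1\le1}\|(\Phi\otimes\mathrm{id}_n)[X]\|_1$. **Theorem (average-case distinguishability of quantum channels).** There is a universal constant $\varepsilon\in[0,1)$ (in particular,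 independent of the dimension) such that the following holds. Let $\Lambda,\Gamma$ be quantum channels on $\mathcal H_d$, let $\delta'\in(0,\frac19)$, and let $\nu$ be a probability measure on $U(\mathcal H_d)$ that is a $\delta$-approximate $4$-design for $\delta=\delta'/(2d)^8$. Let $\psi_0=|\varphi\rangle\langle\varphi|$, $\|\varphi\|=1$, be a pure state on $\mathcal H_d$, and let $p^{\Lambda,V,U}_i=\mathrm{tr}\big(|i\rangle\langle i|\,U\Lambda(V\psi_0V^\dagger)U^\dagger\big)$, $i=1,\dots,d$, be the outcome distribution when $V$, then the channel $\Lambda$, then $U$ are applied to $\psi_0$ and the result is measured in the computational basis. Then $$\Big|\ \mathbb E_{V\sim\nu}\,\mathbb E_{U\sim\nu}\,\mathrm{TV}\big(p^{\Lambda,V,U},p^{\Gamma,V,U}\big)-d^{\mathrm{ch}}_{\mathrm{av}}(\Lambda,\Gamma)\Big|\ \le\ \varepsilon\; d^{\mathrm{ch}}_{\mathrm{av}}(\Lambda,\Gamma),$$ where $$d^{\mathrm{ch}}_{\mathrm{av}}(\Lambda,\Gamma)=\frac12\sqrt{\|\mathcal J_\Lambda-\mathcal J_\Gamma\|_{HS}^2+\mathrm{tr}\big(((\Lambda-\Gamma)[\tau_d])^2\big)}.$$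 -/

import Mathlib

open MeasureTheory
open scoped ENNReal Matrix ComplexOrder

noncomputable section

/-! ### The unitary group as a compact measurable group -/

/-- The group `U(H_d)` of unitary operators on `H_d = ℂ^d`. -/
abbrev Unitaries (d : ℕ) : Type := Matrix.unitaryGroup (Fin d) ℂ

/-- The Borel sigma-algebra of the unitary group. -/
instance instMeasurableSpaceUnitaries (d : ℕ) : MeasurableSpace (Unitaries d) := borel _

instance instBorelSpaceUnitaries (d : ℕ) : BorelSpace (Unitaries d) := ⟨rfl⟩

instance instCompactSpaceUnitaries (d : ℕ) : CompactSpace (Unitaries d) := by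
  suffices h : IsCompact (Matrix.unitaryGroup (Fin d) ℂ : Set (Matrix (Fin d) (Fin d) ℂ)) from
    isCompact_iff_compactSpace.mp h
  have hK : IsCompact (Set.univ.pi fun _ : Fin d => Set.univ.pi fun _ : Fin d =>
      Metric.closedBall (0 : ℂ) 1) :=
    isCompact_univ_pi fun _ => isCompact_univ_pi fun _ => isCompact_closedBall _ _
  refine IsCompact.of_isClosed_subset hK ?_ ?_
  · have h : ((Matrix.unitaryGroup (Fin d) ℂ : Set (Matrix (Fin d) (Fin d) ℂ))) =
        {U | star U * U = 1} := by
      ext U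
      exact Matrix.mem_unitaryGroup_iff'
    rw [h]
    exact isClosed_eq (by fun_prop) continuous_const
  · intro U hU i _ j _
    simpa using entry_norm_bound_of_unitary hU i j

/-- The normalized Haar measure on the unitary group. -/
def haarUnitary (d : ℕ) : Measure (Unitaries d) := Measure.haarMeasure ⊤

instance instIsProbabilityMeasureHaarUnitary (d : ℕ) : IsProbabilityMeasure (haarUnitary d) :=
  ⟨by simpa [haarUnitary] using Measure.haarMeasure_self (K₀ := (⊤ : TopologicalSpace.PositiveCompacts
      (Unitaries d)))⟩

/-! ### Norms and superoperators -/

/-- The trace norm `‖X‖₁`: the sum of the singular values of `X`. -/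
def traceNorm {ι : Type*} [Fintype ι] [DecidableEq ι] (X : Matrix ι ι ℂ) : ℝ :=
  ∑ i, √((Matrix.isHermitian_conjTranspose_mul_self X).eigenvalues i)

/-- The Hilbert-Schmidt norm `√(tr (X† X))`; it is `√(tr (X²))` for Hermitian `X`. -/
def hsNorm {ι : Type*} [Fintype ι] (X : Matrix ι ι ℂ) : ℝ :=
  √((Xᴴ * X).trace.re)

/-- `(Φ ⊗ id)[X]` for a superoperator `Φ`, with an ancilla with orthonormal basis
indexed by `α`. -/
def ampliate {ι κ : Type*} (α : Type*)
    (Φ : Matrix ι ι ℂ →ₗ[ℂ] Matrix κ κ ℂ) (X : Matrix (ι × α) (ι × α) ℂ) :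
    Matrix (κ × α) (κ × α) ℂ :=
  Matrix.of fun p q => Φ (Matrix.of fun i j => X (i, p.2) (j, q.2)) p.1 q.1

/-- The diamond norm `sup_n sup_{‖X‖₁ ≤ 1} ‖(Φ ⊗ id_n)[X]‖₁`. -/
def diamondNorm {ι κ : Type*} [Fintype ι] [DecidableEq ι] [Fintype κ] [DecidableEq κ]
    (Φ : Matrix ι ι ℂ →ₗ[ℂ] Matrix κ κ ℂ) : ℝ≥0∞ :=
  ⨆ (n : ℕ) (X : Matrix (ι × Fin n) (ι × Fin n) ℂ) (_ : traceNorm X ≤ 1),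
    ENNReal.ofReal (traceNorm (ampliate (Fin n) Φ X))

/-! ### Approximate unitary designs -/

/-- The `k`-fold tensor power `U^{⊗k}` acting on `(ℂ^d)^{⊗k}`, whose product basis is indexed by
`Fin k → Fin d`. -/
def tensorPower {d : ℕ} (k : ℕ) (U : Matrix (Fin d) (Fin d) ℂ) :
    Matrix (Fin k → Fin d) (Fin k → Fin d) ℂ :=
  Matrix.of fun a b => ∏ i, U (a i) (b i)

lemma continuous_twirl_entry {d : ℕ} (k : ℕ) (X : Matrix (Fin k → Fin d) (Fin k → Fin d) ℂ)
    (a b : Fin k → Fin d) :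
    Continuous fun U : Unitaries d =>
      (tensorPower k U.1 * X * (tensorPower k U.1)ᴴ) a b := by
  have h : Continuous fun U : Unitaries d => tensorPower k U.1 := by
    refine continuous_matrix fun a b => ?_
    simp only [tensorPower, Matrix.of_apply]
    exact continuous_finsetProd _ fun i _ => continuous_subtype_val.matrix_elem _ _
  exact ((h.matrix_mul continuous_const).matrix_mul h.matrix_conjTranspose).matrix_elem a b

lemma integrable_twirl_entry {d : ℕ} (k : ℕ) (ν : Measure (Unitaries d)) [IsFiniteMeasure ν]
    (X : Matrix (Fin k → Fin d) (Fin k → Fin d) ℂ) (a b : Fin k → Fin d) :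
    Integrable (fun U : Unitaries d =>
      (tensorPower k U.1 * X * (tensorPower k U.1)ᴴ) a b) ν :=
  (continuous_twirl_entry k X a b).integrable_of_hasCompactSupport
    (HasCompactSupport.of_compactSpace _)

/-- The `k`-th moment superoperator `T_{k,ν}[X] = ∫ U^{⊗k} X (U†)^{⊗k} dν(U)`
(integrated entrywise). -/
def momentMap {d : ℕ} (k : ℕ) (ν : Measure (Unitaries d)) [IsFiniteMeasure ν] :
    Matrix (Fin k → Fin d) (Fin k → Fin d) ℂ →ₗ[ℂ]
      Matrix (Fin k → Fin d) (Fin k → Fin d) ℂ where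
  toFun X := Matrix.of fun a b =>
    ∫ U : Unitaries d, (tensorPower k U.1 * X * (tensorPower k U.1)ᴴ) a b ∂ν
  map_add' X Y := by
    ext a b
    simp only [Matrix.of_apply, Matrix.add_apply, mul_add, add_mul]
    exact integral_add (integrable_twirl_entry k ν X a b) (integrable_twirl_entry k ν Y a b)
  map_smul' c X := by
    ext a b
    simp only [Matrix.of_apply, Matrix.smul_apply, Matrix.mul_smul, Matrix.smul_mul,
      RingHom.id_apply]
    exact integral_smul c _

/-- `ν` is a `δ`-approximate unitary `k`-design: `‖T_{k,ν} - T_{k,Haar}‖_⋄ ≤ δ`. -/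
def IsApproxDesign {d : ℕ} (δ : ℝ) (k : ℕ) (ν : Measure (Unitaries d)) [IsFiniteMeasure ν] :
    Prop :=
  diamondNorm (momentMap k ν - momentMap k (haarUnitary d)) ≤ ENNReal.ofReal δ

/-! ### Quantum channels -/

/-- Quantum channels on `H_d`: completely positive trace-preserving linear maps. -/
structure IsQuantumChannel {d : ℕ}
    (Λ : Matrix (Fin d) (Fin d) ℂ →ₗ[ℂ] Matrix (Fin d) (Fin d) ℂ) : Prop where
  completelyPositive : ∀ (n : ℕ) (X : Matrix (Fin d × Fin n) (Fin d × Fin n) ℂ),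
    X.PosSemidef → (ampliate (Fin n) Λ X).PosSemidef
  tracePreserving : ∀ X : Matrix (Fin d) (Fin d) ℂ, (Λ X).trace = X.trace

/-- The maximally mixed state `τ_d = 1/d`. -/
def maxMixed (d : ℕ) : Matrix (Fin d) (Fin d) ℂ := (d : ℂ)⁻¹ • 1

/-- The maximally entangled state `|Ω⟩⟨Ω|` with `Ω = d^{-1/2} ∑ i, |i⟩ ⊗ |i⟩`. -/
def maxEntangled (d : ℕ) : Matrix (Fin d × Fin d) (Fin d × Fin d) ℂ :=
  Matrix.of fun p q => if p.1 = p.2 ∧ q.1 = q.2 then (d : ℂ)⁻¹ else 0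

/-- The Choi-Jamiolkowski state `J_Λ = (Λ ⊗ id)[|Ω⟩⟨Ω|]`. -/
def choiState {d : ℕ} (Λ : Matrix (Fin d) (Fin d) ℂ →ₗ[ℂ] Matrix (Fin d) (Fin d) ℂ) :
    Matrix (Fin d × Fin d) (Fin d × Fin d) ℂ :=
  ampliate (Fin d) Λ (maxEntangled d)

/-- The average-case distance of channels
`(1/2) √(‖J_Λ - J_Γ‖_HS² + tr(((Λ - Γ)[τ_d])²))`. -/
def averageCaseDistance {d : ℕ}
    (Λ Γ : Matrix (Fin d) (Fin d) ℂ →ₗ[ℂ] Matrix (Fin d) (Fin d) ℂ) : ℝ :=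
  1 / 2 * √(hsNorm (choiState Λ - choiState Γ) ^ 2
    + (((Λ - Γ) (maxMixed d)) ^ 2).trace.re)

/-! ### The measurement process -/

/-- The pure state `|φ⟩⟨φ|`. -/
def pureState {d : ℕ} (φ : EuclideanSpace ℂ (Fin d)) : Matrix (Fin d) (Fin d) ℂ :=
  Matrix.of fun i j => φ i * star (φ j)

/-- The probability `tr(|i⟩⟨i| U Λ(V ψ V†) U†)` of the outcome `i`, when `ψ` is evolved by `V`,
then by `Λ`, then by `U`, and measured in the computational basis. -/
def outcomeProb {d : ℕ} (Λ : Matrix (Fin d) (Fin d) ℂ →ₗ[ℂ] Matrix (Fin d) (Fin d) ℂ)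
    (ψ : Matrix (Fin d) (Fin d) ℂ) (V U : Unitaries d) (i : Fin d) : ℝ :=
  (Matrix.single i i 1 * (U.1 * Λ (V.1 * ψ * V.1ᴴ) * U.1ᴴ)).trace.re

/-- The total variation distance of two distributions on a finite set. -/
def tvDist {ι : Type*} [Fintype ι] (p q : ι → ℝ) : ℝ := 1 / 2 * ∑ i, |p i - q i|

/-- The average total variation distance between the outputs for `Λ` and `Γ`, over independent
`V` and `U` with distribution `ν`. -/
def averageTV {d : ℕ} (ν : Measure (Unitaries d)) (φ : EuclideanSpace ℂ (Fin d))
    (Λ Γ : Matrix (Fin d) (Fin d) ℂ →ₗ[ℂ] Matrix (Fin d) (Fin d) ℂ) : ℝ :=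
  ∫ V, ∫ U, tvDist (outcomeProb Λ (pureState φ) V U) (outcomeProb Γ (pureState φ) V U) ∂ν ∂ν

end

/-! Write `D` for the average-case distance and `x` for the difference of the two probabilities of
one fixed outcome, a random variable in `(V, U)`. Its second moment is about `4 D² / (d + 1)²` and
its fourth moment is at most a constant times `D⁴ / d⁴`. Such a variable cannot concentrate near
zero, so `E|x|` lies between constant multiples of `D / d`. Summing over the `d` outcomes compares
the average total variation distance with `D`, with constants free of `d`.

The moments are computed in two stages. For fixed `V`, the matrix `A = (Λ - Γ)[VψV†]` is Hermitian
and traceless, so the Haar average over `U` of `x²` is `‖A‖²_HS / (d (d + 1))`. In turn `‖A‖²_HS` is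
a sum of squares of expectation values of Hermitian matrices in the state `VψV†`; its Haar average
is again a second moment, and the total weight is `4 d² D²` by `sum_entryFunctional_eq`.

The Haar moments follow from left invariance alone: differentiating along plane rotations gives the
recursion `integral_diagForm_pow_succ`, hence the exact second moment and a bound on the fourth.
`IsApproxDesign.norm_integral_sub_le` transfers both to a design, where the factor `d⁻⁸` in `δ`
absorbs every dimensional loss. The passage to `E|x|` is `integral_abs_le_of_integral_sq_le` and
`le_integral_abs_of_moments`. -/

/-! ### Comparison of the Hilbert-Schmidt, trace and diamond norms. -/

lemma hsNorm_nonneg {ι : Type*} [Fintype ι] (X : Matrix ι ι ℂ) : 0 ≤ hsNorm X := Real.sqrt_nonneg _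

lemma trace_conjTranspose_mul_self_re {ι : Type*} [Fintype ι] (X : Matrix ι ι ℂ) :
    (Xᴴ * X).trace.re = ∑ i, ∑ j, ‖X i j‖ ^ 2 := by
  rw [Finset.sum_comm]
  simp only [Matrix.trace, Matrix.diag_apply, Matrix.mul_apply, Complex.re_sum,
    Matrix.conjTranspose_apply]
  refine Finset.sum_congr rfl fun i _ => Finset.sum_congr rfl fun j _ => ?_
  rw [Complex.star_def, ← Complex.normSq_eq_conj_mul_self, Complex.ofReal_re,
    Complex.normSq_eq_norm_sq]

lemma hsNorm_sq {ι : Type*} [Fintype ι] (X : Matrix ι ι ℂ) :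
    hsNorm X ^ 2 = ∑ i, ∑ j, ‖X i j‖ ^ 2 := by
  rw [hsNorm, Real.sq_sqrt, trace_conjTranspose_mul_self_re]
  rw [trace_conjTranspose_mul_self_re]
  positivity

lemma hsNorm_smul {ι : Type*} [Fintype ι] (c : ℝ) (hc : 0 ≤ c) (X : Matrix ι ι ℂ) :
    hsNorm ((c : ℂ) • X) = c * hsNorm X := by
  rw [← sq_eq_sq₀ (hsNorm_nonneg _) (mul_nonneg hc (hsNorm_nonneg _)), mul_pow, hsNorm_sq, hsNorm_sq]
  simp [mul_pow, Finset.mul_sum]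

lemma sum_eigenvalues_eq_hsNorm_sq {ι : Type*} [Fintype ι] [DecidableEq ι] (X : Matrix ι ι ℂ) :
    ∑ i, (Matrix.isHermitian_conjTranspose_mul_self X).eigenvalues i = hsNorm X ^ 2 := by
  have h := (Matrix.isHermitian_conjTranspose_mul_self X).trace_eq_sum_eigenvalues
  rw [hsNorm_sq, ← trace_conjTranspose_mul_self_re, h, ← Complex.ofReal_re (∑ i, _)]
  simp

lemma eigenvalues_conjTranspose_mul_self_nonneg {ι : Type*} [Fintype ι] [DecidableEq ι]
    (X : Matrix ι ι ℂ) (i : ι) :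
    0 ≤ (Matrix.isHermitian_conjTranspose_mul_self X).eigenvalues i :=
  (Matrix.posSemidef_conjTranspose_mul_self X).eigenvalues_nonneg i

lemma traceNorm_nonneg {ι : Type*} [Fintype ι] [DecidableEq ι] (X : Matrix ι ι ℂ) :
    0 ≤ traceNorm X := Finset.sum_nonneg fun _ _ => Real.sqrt_nonneg _

lemma hsNorm_le_traceNorm {ι : Type*} [Fintype ι] [DecidableEq ι] (X : Matrix ι ι ℂ) :
    hsNorm X ≤ traceNorm X := by
  rw [← sq_le_sq₀ (hsNorm_nonneg _) (traceNorm_nonneg _), ← sum_eigenvalues_eq_hsNorm_sq]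
  have h := Finset.sum_sq_le_sq_sum_of_nonneg (s := Finset.univ) (f := fun i =>
    √((Matrix.isHermitian_conjTranspose_mul_self X).eigenvalues i)) (fun _ _ => Real.sqrt_nonneg _)
  simpa [traceNorm, Real.sq_sqrt (eigenvalues_conjTranspose_mul_self_nonneg X _)] using h

/-- Cauchy-Schwarz for the vector of singular values. -/
lemma traceNorm_le_sqrt_card_mul_hsNorm {ι : Type*} [Fintype ι] [DecidableEq ι]
    (X : Matrix ι ι ℂ) : traceNorm X ≤ √(Fintype.card ι) * hsNorm X := by
  rw [← sq_le_sq₀ (traceNorm_nonneg _) (mul_nonneg (Real.sqrt_nonneg _) (hsNorm_nonneg _)),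
    mul_pow, Real.sq_sqrt (Nat.cast_nonneg _), ← sum_eigenvalues_eq_hsNorm_sq]
  have h := sq_sum_le_card_mul_sum_sq (s := (Finset.univ : Finset ι)) (f := fun i =>
    √((Matrix.isHermitian_conjTranspose_mul_self X).eigenvalues i))
  simpa [traceNorm, Real.sq_sqrt (eigenvalues_conjTranspose_mul_self_nonneg X _)] using h

lemma norm_trace_mul_le {ι : Type*} [Fintype ι] (O Y : Matrix ι ι ℂ) :
    ‖(O * Y).trace‖ ≤ hsNorm O * hsNorm Y := by
  have h1 : ‖(O * Y).trace‖ ≤ ∑ p : ι × ι, ‖O p.1 p.2‖ * ‖Y p.2 p.1‖ := by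
    rw [Fintype.sum_prod_type]
    simp only [Matrix.trace, Matrix.diag_apply, Matrix.mul_apply]
    refine (norm_sum_le _ _).trans (Finset.sum_le_sum fun i _ => (norm_sum_le _ _).trans ?_)
    exact Finset.sum_le_sum fun j _ => (norm_mul _ _).le
  refine h1.trans (abs_le_of_sq_le_sq' ?_ (mul_nonneg (hsNorm_nonneg _) (hsNorm_nonneg _))).2
  refine (Finset.sum_mul_sq_le_sq_mul_sq _ _ _).trans (le_of_eq ?_)
  rw [mul_pow, hsNorm_sq, hsNorm_sq, Fintype.sum_prod_type, Fintype.sum_prod_type, Finset.sum_comm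
    (f := fun x y => ‖Y y x‖ ^ 2)]

/-- The diamond norm controls the Hilbert-Schmidt norm of outputs. -/
lemma hsNorm_apply_le_of_diamondNorm_le {ι κ : Type*} [Fintype ι] [DecidableEq ι] [Fintype κ]
    [DecidableEq κ] {Φ : Matrix ι ι ℂ →ₗ[ℂ] Matrix κ κ ℂ} {δ : ℝ} (hδ : 0 ≤ δ)
    (h : diamondNorm Φ ≤ ENNReal.ofReal δ) (X : Matrix ι ι ℂ) :
    hsNorm (Φ X) ≤ δ * (√(Fintype.card ι) * hsNorm X) := by
  have key : ∀ X : Matrix ι ι ℂ, √(Fintype.card ι) * hsNorm X ≤ 1 → hsNorm (Φ X) ≤ δ := by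
    intro X hX
    -- A one-dimensional ancilla is enough: the supremum is used only at `n = 1`.
    let Z : Matrix (ι × Fin 1) (ι × Fin 1) ℂ := Matrix.of fun p q => X p.1 q.1
    have hZ : hsNorm Z = hsNorm X := by
      rw [← sq_eq_sq₀ (hsNorm_nonneg _) (hsNorm_nonneg _), hsNorm_sq, hsNorm_sq]
      simp [Z, Fintype.sum_prod_type]
    have hΦ : hsNorm (ampliate (Fin 1) Φ Z) = hsNorm (Φ X) := by
      rw [← sq_eq_sq₀ (hsNorm_nonneg _) (hsNorm_nonneg _), hsNorm_sq, hsNorm_sq]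
      have : (Matrix.of fun i j => X i j) = X := rfl
      simp [Z, ampliate, Fintype.sum_prod_type, this]
    have hZ1 : traceNorm Z ≤ 1 := by
      refine (traceNorm_le_sqrt_card_mul_hsNorm Z).trans ?_
      simpa [hZ] using hX
    have h2 : ENNReal.ofReal (traceNorm (ampliate (Fin 1) Φ Z)) ≤ ENNReal.ofReal δ := by
      refine le_trans ?_ h
      exact le_iSup_of_le 1 (le_iSup_of_le Z (le_iSup_of_le hZ1 le_rfl))
    rw [ENNReal.ofReal_le_ofReal_iff hδ] at h2
    exact hΦ ▸ (hsNorm_le_traceNorm _).trans h2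
  set c := √(Fintype.card ι) * hsNorm X with hc
  have hc0 : 0 ≤ c := mul_nonneg (Real.sqrt_nonneg _) (hsNorm_nonneg _)
  -- The general case is `key` rescaled by `c⁻¹`; if `c = 0`, all entries of `X` vanish.
  rcases hc0.eq_or_lt with h0 | hpos
  · have hX : ∀ i j, X i j = 0 := by
      intro i j
      have : Nonempty ι := ⟨i⟩
      have h3 : hsNorm X = 0 := by
        rcases mul_eq_zero.1 (hc.symm.trans h0.symm) with h | h
        · rw [Real.sqrt_eq_zero (Nat.cast_nonneg _)] at h
          simp at h
        · exact h
      have h4 := hsNorm_sq X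
      rw [h3] at h4
      have h5 : ‖X i j‖ ^ 2 ≤ ∑ i, ∑ j, ‖X i j‖ ^ 2 :=
        (Finset.single_le_sum (f := fun j => ‖X i j‖ ^ 2) (fun _ _ => by positivity)
          (Finset.mem_univ j)).trans (Finset.single_le_sum (f := fun i => ∑ j, ‖X i j‖ ^ 2)
          (fun _ _ => by positivity) (Finset.mem_univ i))
      have h6 : ‖X i j‖ ^ 2 ≤ 0 := by linarith
      simpa using h6
    have : X = 0 := by ext i j; exact hX i j
    have h7 : hsNorm (Φ X) = 0 := by simp [this, hsNorm]
    rw [h7]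
    positivity
  · have h1 := key (((c⁻¹ : ℝ) : ℂ) • X) (by
      rw [hsNorm_smul _ (by positivity)]
      rw [mul_left_comm, ← hc, inv_mul_cancel₀ hpos.ne'])
    rw [map_smul, hsNorm_smul _ (by positivity), inv_mul_le_iff₀ hpos] at h1
    linarith [mul_comm δ c]

/-! ### Products of expectation values under the moment superoperator. -/

/-- The tensor product of a finite family of matrices. -/
noncomputable def tensorFamily {d k : ℕ} (O : Fin k → Matrix (Fin d) (Fin d) ℂ) :
    Matrix (Fin k → Fin d) (Fin k → Fin d) ℂ :=
  Matrix.of fun a b => ∏ i, O i (a i) (b i)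

lemma tensorFamily_mul {d k : ℕ} (O X : Fin k → Matrix (Fin d) (Fin d) ℂ) :
    tensorFamily O * tensorFamily X = tensorFamily fun i => O i * X i := by
  ext a b
  simp only [tensorFamily, Matrix.mul_apply, Matrix.of_apply]
  rw [Finset.prod_univ_sum, Fintype.piFinset_univ]
  exact Finset.sum_congr rfl fun c _ => Finset.prod_mul_distrib.symm

lemma conjTranspose_tensorPower {d k : ℕ} (U : Matrix (Fin d) (Fin d) ℂ) :
    (tensorPower k U)ᴴ = tensorFamily fun _ => Uᴴ := by
  ext a b
  simp [tensorPower, tensorFamily, Matrix.conjTranspose_apply]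

lemma trace_tensorFamily {d k : ℕ} (O : Fin k → Matrix (Fin d) (Fin d) ℂ) :
    (tensorFamily O).trace = ∏ i, (O i).trace := by
  simp only [tensorFamily, Matrix.trace, Matrix.diag_apply, Matrix.of_apply]
  rw [Finset.prod_univ_sum, Fintype.piFinset_univ]

lemma hsNorm_tensorFamily {d k : ℕ} (O : Fin k → Matrix (Fin d) (Fin d) ℂ) :
    hsNorm (tensorFamily O) = ∏ i, hsNorm (O i) := by
  rw [← sq_eq_sq₀ (hsNorm_nonneg _) (Finset.prod_nonneg fun _ _ => hsNorm_nonneg _),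
    ← Finset.prod_pow, hsNorm_sq]
  simp only [hsNorm_sq]
  rw [Finset.prod_univ_sum, Fintype.piFinset_univ]
  refine Finset.sum_congr rfl fun a _ => ?_
  rw [Finset.prod_univ_sum, Fintype.piFinset_univ]
  simp [tensorFamily, Finset.prod_pow]

lemma continuous_trace_conj {d : ℕ} (O X : Matrix (Fin d) (Fin d) ℂ) :
    Continuous fun U : Unitaries d => (O * (U.1 * X * U.1ᴴ)).trace := by
  have h : Continuous fun U : Unitaries d => U.1 := continuous_subtype_val
  exact (continuous_const.matrix_mul ((h.matrix_mul continuous_const).matrix_mul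
    h.matrix_conjTranspose)).matrix_trace

lemma Continuous.integrable_of_compact {Ω E : Type*} [TopologicalSpace Ω] [CompactSpace Ω]
    [MeasurableSpace Ω] [OpensMeasurableSpace Ω] [NormedAddCommGroup E] {f : Ω → E}
    [SecondCountableTopologyEither Ω E]
    (hf : Continuous f) (ν : Measure Ω) [IsFiniteMeasure ν] : Integrable f ν :=
  hf.integrable_of_hasCompactSupport (HasCompactSupport.of_compactSpace _)

/-- A product of traces is the trace of a tensor product, so the integrand is linear in the twirled
matrix, and the entrywise integral passes through the finite sums. All dependence on `ν` is thereby
confined to `momentMap`. -/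
lemma integral_prod_trace_eq {d k : ℕ} (ν : Measure (Unitaries d)) [IsFiniteMeasure ν]
    (O X : Fin k → Matrix (Fin d) (Fin d) ℂ) :
    ∫ U : Unitaries d, ∏ r, (O r * (U.1 * X r * U.1ᴴ)).trace ∂ν
      = (tensorFamily O * momentMap k ν (tensorFamily X)).trace := by
  have h : ∀ U : Unitaries d, ∏ r, (O r * (U.1 * X r * U.1ᴴ)).trace =
      ∑ a, ∑ b, tensorFamily O a b *
        (tensorPower k U.1 * tensorFamily X * (tensorPower k U.1)ᴴ) b a := by
    intro U
    rw [← trace_tensorFamily, ← tensorFamily_mul, ← tensorFamily_mul, ← tensorFamily_mul,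
      ← conjTranspose_tensorPower]
    simp only [Matrix.trace, Matrix.diag_apply, Matrix.mul_apply (M := tensorFamily O)]
    rfl
  simp only [h]
  rw [integral_finsetSum]
  · simp only [Matrix.trace, Matrix.diag_apply, Matrix.mul_apply (M := tensorFamily O)]
    refine Finset.sum_congr rfl fun a _ => ?_
    rw [integral_finsetSum]
    · refine Finset.sum_congr rfl fun b _ => ?_
      rw [integral_const_mul]
      rfl
    · exact fun b _ => (integrable_twirl_entry k ν _ b a).const_mul _
  · exact fun a _ => integrable_finsetSum _ fun b _ =>
      (integrable_twirl_entry k ν _ b a).const_mul _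

/-- Products of expectation values are almost the same for an approximate design as for the Haar
measure. -/
lemma IsApproxDesign.norm_integral_sub_le {d k : ℕ} {δ : ℝ} (hδ : 0 ≤ δ)
    {ν : Measure (Unitaries d)} [IsFiniteMeasure ν] (h : IsApproxDesign δ k ν)
    (O X : Fin k → Matrix (Fin d) (Fin d) ℂ) :
    ‖∫ U : Unitaries d, ∏ r, (O r * (U.1 * X r * U.1ᴴ)).trace ∂ν -
      ∫ U : Unitaries d, ∏ r, (O r * (U.1 * X r * U.1ᴴ)).trace ∂(haarUnitary d)‖ ≤
      δ * √((d : ℝ) ^ k) * ((∏ r, hsNorm (O r)) * ∏ r, hsNorm (X r)) := by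
  rw [integral_prod_trace_eq, integral_prod_trace_eq, ← Matrix.trace_sub, ← Matrix.mul_sub,
    ← LinearMap.sub_apply]
  refine (norm_trace_mul_le _ _).trans ?_
  have h1 := hsNorm_apply_le_of_diamondNorm_le hδ h (tensorFamily X)
  rw [← hsNorm_tensorFamily, ← hsNorm_tensorFamily]
  refine (mul_le_mul_of_nonneg_left h1 (hsNorm_nonneg _)).trans (le_of_eq ?_)
  simp
  ring

/-! ### Haar moments of a column of a random unitary -/

instance instIsMulLeftInvariantHaarUnitary (d : ℕ) : (haarUnitary d).IsMulLeftInvariant := by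
  unfold haarUnitary
  infer_instance

/-- Ensures that continuous functions on a product of two copies of the group are measurable for the
product sigma-algebra, as Fubini requires. -/
instance instSecondCountableTopologyUnitaries (d : ℕ) : SecondCountableTopology (Unitaries d) := by
  have : SecondCountableTopology (Matrix (Fin d) (Fin d) ℂ) :=
    inferInstanceAs (SecondCountableTopology (Fin d → Fin d → ℂ))
  exact TopologicalSpace.Subtype.secondCountableTopology _

/-- Integrate `f (U⁻¹ * V)` over both variables: left invariance in `V` gives one side, left
invariance in `U` gives the other, and Fubini equates them. -/
lemma integral_haarUnitary_inv {d : ℕ} {f : Unitaries d → ℝ} (hf : Continuous f) :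
    ∫ U, f U⁻¹ ∂(haarUnitary d) = ∫ U, f U ∂(haarUnitary d) := by
  have h1 : ∀ U : Unitaries d, ∫ V, f (U⁻¹ * V) ∂(haarUnitary d) = ∫ V, f V ∂(haarUnitary d) :=
    fun U => integral_mul_left_eq_self f U⁻¹
  have h2 : ∀ V : Unitaries d, ∫ U, f (U⁻¹ * V) ∂(haarUnitary d) =
      ∫ U, f U⁻¹ ∂(haarUnitary d) := fun V => by
    simpa using integral_mul_left_eq_self (μ := haarUnitary d) (fun U => f U⁻¹) V⁻¹
  have hc : Continuous fun q : Unitaries d × Unitaries d => f (q.1⁻¹ * q.2) := by fun_prop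
  have h3 := integral_integral_swap (f := fun U V : Unitaries d => f (U⁻¹ * V))
    (μ := haarUnitary d) (ν := haarUnitary d) (hc.integrable_of_compact _)
  simpa [h1, h2] using h3.symm

/-- Integration by parts on the group: by left invariance the integral of `f (R t * V)` does not
depend on `t`, and compactness bounds the derivative uniformly, so one may differentiate under the
integral. -/
lemma integral_haarUnitary_deriv_eq_zero {d : ℕ} (R : ℝ → Unitaries d) (hR : R 0 = 1)
    {f g : Unitaries d → ℝ} (hf : Continuous f) (hg : Continuous g)
    (h : ∀ V t, HasDerivAt (fun t => f (R t * V)) (g (R t * V)) t) :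
    ∫ V, g V ∂(haarUnitary d) = 0 := by
  obtain ⟨C, hC⟩ := (isCompact_range hg).isBounded.exists_norm_le
  have h1 := (hasDerivAt_integral_of_dominated_loc_of_deriv_le (μ := haarUnitary d)
    (F := fun t V => f (R t * V)) (F' := fun t V => g (R t * V)) (x₀ := 0) (bound := fun _ => C)
    Filter.univ_mem (.of_forall fun t => (by fun_prop : Continuous fun V => f (R t * V)).aestronglyMeasurable)
    ((by fun_prop : Continuous fun V => f (R 0 * V)).integrable_of_compact _)
    (by fun_prop : Continuous fun V => g (R 0 * V)).aestronglyMeasurable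
    (.of_forall fun V t _ => hC _ ⟨_, rfl⟩) (integrable_const _)
    (.of_forall fun V t _ => h V t)).2
  have h2 : (fun t => ∫ V, f (R t * V) ∂(haarUnitary d)) = fun _ => ∫ V, f V ∂(haarUnitary d) :=
    funext fun t => integral_mul_left_eq_self f (R t)
  rw [h2] at h1
  simpa [hR] using h1.unique (hasDerivAt_const 0 _)

/-- The vector `V φ`. -/
def rotated {d : ℕ} (φ : Fin d → ℂ) (V : Unitaries d) : Fin d → ℂ := V.1 *ᵥ φ

lemma rotated_mul {d : ℕ} (φ : Fin d → ℂ) (R V : Unitaries d) :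
    rotated φ (R * V) = R.1 *ᵥ rotated φ V := by
  simp [rotated, Matrix.mulVec_mulVec]

@[fun_prop]
lemma continuous_rotated {d : ℕ} (φ : Fin d → ℂ) (k : Fin d) :
    Continuous fun V : Unitaries d => rotated φ V k :=
  (continuous_apply k).comp (continuous_subtype_val.matrix_mulVec continuous_const)

/-- The rotation by the angle `t` in the plane of the coordinates `i` and `j`. -/
noncomputable def planeRotation {d : ℕ} (i j : Fin d) (t : ℝ) : Matrix (Fin d) (Fin d) ℂ :=
  1 + ((Real.cos t : ℂ) - 1) • (Matrix.single i i 1 + Matrix.single j j 1) +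
    (Real.sin t : ℂ) • (Matrix.single i j 1 - Matrix.single j i 1)

lemma planeRotation_mulVec {d : ℕ} {i j : Fin d} (hij : i ≠ j) (t : ℝ) (w : Fin d → ℂ)
    (k : Fin d) : (planeRotation i j t *ᵥ w) k =
      if k = i then Real.cos t * w i + Real.sin t * w j
      else if k = j then Real.cos t * w j - Real.sin t * w i else w k := by
  simp only [planeRotation, Matrix.add_mulVec, Matrix.sub_mulVec, Matrix.smul_mulVec,
    Matrix.one_mulVec, Matrix.single_mulVec, Pi.add_apply, Pi.sub_apply, Pi.smul_apply,
    smul_eq_mul, Function.update_apply, Pi.zero_apply, one_mul]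
  by_cases h1 : k = i
  · subst h1; simp [hij]; ring
  · by_cases h2 : k = j
    · subst h2; simp [h1]; ring
    · simp [h1, h2]

lemma planeRotation_mem {d : ℕ} {i j : Fin d} (hij : i ≠ j) (t : ℝ) :
    planeRotation i j t ∈ Matrix.unitaryGroup (Fin d) ℂ := by
  rw [Matrix.mem_unitaryGroup_iff, Matrix.star_eq_conjTranspose]
  have hs : (planeRotation i j t)ᴴ = planeRotation i j (-t) := by
    simp only [planeRotation, Matrix.conjTranspose_add, Matrix.conjTranspose_sub,
      Matrix.conjTranspose_smul, Matrix.conjTranspose_single, Matrix.conjTranspose_one, star_one,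
      star_sub, Complex.star_def, Complex.conj_ofReal, Real.cos_neg, Real.sin_neg]
    push_cast
    module
  rw [hs]
  ext a b
  have h : (planeRotation i j t * planeRotation i j (-t)) a b =
      (planeRotation i j t *ᵥ (planeRotation i j (-t) *ᵥ Pi.single b 1)) a := by
    rw [Matrix.mulVec_mulVec]; simp
  have hcs : (Real.cos t : ℂ) * Real.cos t + Real.sin t * Real.sin t = 1 := by
    norm_cast; nlinarith [Real.sin_sq_add_cos_sq t]
  rw [h, planeRotation_mulVec hij]
  simp only [planeRotation_mulVec hij, hij, hij.symm, if_true, if_false, Real.cos_neg, Real.sin_neg,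
    Complex.ofReal_neg]
  have h1 : (1 : Matrix (Fin d) (Fin d) ℂ) a b = Pi.single (M := fun _ => ℂ) b 1 a := by
    simp [Matrix.one_apply, Pi.single_apply]
  rw [h1]
  split_ifs with h2 h3
  · subst h2; linear_combination (Pi.single (M := fun _ => ℂ) b 1 a) * hcs
  · subst h3; linear_combination (Pi.single (M := fun _ => ℂ) b 1 a) * hcs
  · rfl

/-- The quadratic form with the diagonal `l` in the coordinates. -/
noncomputable def diagForm {d : ℕ} (l : Fin d → ℝ) (w : Fin d → ℂ) : ℝ :=
  ∑ k, l k * Complex.normSq (w k)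

@[fun_prop]
lemma continuous_diagForm {d : ℕ} (l : Fin d → ℝ) (φ : Fin d → ℂ) :
    Continuous fun V : Unitaries d => diagForm l (rotated φ V) := by
  unfold diagForm
  exact continuous_finsetSum _ fun k _ =>
    continuous_const.mul (Complex.continuous_normSq.comp (continuous_rotated φ k))

lemma hasDerivAt_planeRotation_re_im {d : ℕ} {i j : Fin d} (hij : i ≠ j) (w : Fin d → ℂ)
    (t : ℝ) (k : Fin d) :
    HasDerivAt (fun t => ((planeRotation i j t *ᵥ w) k).re)
      (if k = i then ((planeRotation i j t *ᵥ w) j).re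
        else if k = j then -((planeRotation i j t *ᵥ w) i).re else 0) t ∧
    HasDerivAt (fun t => ((planeRotation i j t *ᵥ w) k).im)
      (if k = i then ((planeRotation i j t *ᵥ w) j).im
        else if k = j then -((planeRotation i j t *ᵥ w) i).im else 0) t := by
  simp only [planeRotation_mulVec hij, hij, hij.symm, if_true, if_false]
  split_ifs with h1 h2
  · simp only [Complex.add_re, Complex.add_im, Complex.re_ofReal_mul, Complex.im_ofReal_mul,
      Complex.sub_re, Complex.sub_im]
    constructor
    · exact (((Real.hasDerivAt_cos t).mul_const (w i).re).fun_add
        ((Real.hasDerivAt_sin t).mul_const (w j).re)).congr_deriv (by ring)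
    · exact (((Real.hasDerivAt_cos t).mul_const (w i).im).fun_add
        ((Real.hasDerivAt_sin t).mul_const (w j).im)).congr_deriv (by ring)
  · simp only [Complex.add_re, Complex.add_im, Complex.re_ofReal_mul, Complex.im_ofReal_mul,
      Complex.sub_re, Complex.sub_im]
    constructor
    · exact (((Real.hasDerivAt_cos t).mul_const (w j).re).fun_sub
        ((Real.hasDerivAt_sin t).mul_const (w i).re)).congr_deriv (by ring)
    · exact (((Real.hasDerivAt_cos t).mul_const (w j).im).fun_sub
        ((Real.hasDerivAt_sin t).mul_const (w i).im)).congr_deriv (by ring)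
  · exact ⟨hasDerivAt_const _ _, hasDerivAt_const _ _⟩

/-- The real part of `w i * conj (w j)`. -/
noncomputable def crossRe {d : ℕ} (i j : Fin d) (w : Fin d → ℂ) : ℝ :=
  (w i).re * (w j).re + (w i).im * (w j).im

@[fun_prop]
lemma continuous_crossRe {d : ℕ} (i j : Fin d) (φ : Fin d → ℂ) :
    Continuous fun V : Unitaries d => crossRe i j (rotated φ V) := by
  unfold crossRe
  have h := fun k => Complex.continuous_re.comp (continuous_rotated φ k)
  have h' := fun k => Complex.continuous_im.comp (continuous_rotated φ k)
  exact ((h i).mul (h j)).add ((h' i).mul (h' j))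

@[fun_prop]
lemma continuous_normSq_rotated {d : ℕ} (φ : Fin d → ℂ) (k : Fin d) :
    Continuous fun V : Unitaries d => Complex.normSq (rotated φ V k) :=
  Complex.continuous_normSq.comp (continuous_rotated φ k)

lemma hasDerivAt_diagForm_planeRotation {d : ℕ} {i j : Fin d} (hij : i ≠ j) (w : Fin d → ℂ)
    (l : Fin d → ℝ) (t : ℝ) :
    HasDerivAt (fun t => diagForm l (planeRotation i j t *ᵥ w))
      (2 * (l i - l j) * crossRe i j (planeRotation i j t *ᵥ w)) t := by
  unfold diagForm
  have h := HasDerivAt.fun_sum (u := Finset.univ) fun k _ =>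
    ((((hasDerivAt_planeRotation_re_im hij w t k).1.pow 2).add
      ((hasDerivAt_planeRotation_re_im hij w t k).2.pow 2)).const_mul (l k))
  refine (h.congr_deriv ?_).congr_of_eventuallyEq (.of_forall fun t => ?_)
  · set v := planeRotation i j t *ᵥ w
    have hk : ∀ k, l k * (2 * (v k).re ^ (2 - 1) *
        (if k = i then (v j).re else if k = j then -(v i).re else 0) +
        2 * (v k).im ^ (2 - 1) * (if k = i then (v j).im else if k = j then -(v i).im else 0)) =
        (if k = i then 2 * l i * crossRe i j v else 0) -
          (if k = j then 2 * l j * crossRe i j v else 0) := by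
      intro k
      unfold crossRe
      by_cases h1 : k = i
      · subst h1; simp [hij]; ring
      · by_cases h2 : k = j
        · subst h2; simp [h1]; ring
        · simp [h1, h2]
    simp only [Nat.cast_ofNat]
    rw [Finset.sum_congr rfl fun k _ => hk k, Finset.sum_sub_distrib]
    simp
    ring
  · simp only [Complex.normSq_apply, Pi.add_apply, Pi.pow_apply]
    exact Finset.sum_congr rfl fun k _ => by ring

/-- The vanishing integral of the derivative of `crossRe i j * diagForm l ^ n` along the plane
rotation. The test function is chosen because `crossRe i j` has derivative `|w j|² - |w i|²`, while
`diagForm l` reproduces `crossRe i j` up to a factor. -/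
lemma integral_rotation_identity {d : ℕ} {i j : Fin d} (hij : i ≠ j) (φ : Fin d → ℂ)
    (l : Fin d → ℝ) (n : ℕ) :
    ∫ V : Unitaries d, ((Complex.normSq (rotated φ V j) - Complex.normSq (rotated φ V i)) *
        diagForm l (rotated φ V) ^ n +
      crossRe i j (rotated φ V) * (n * diagForm l (rotated φ V) ^ (n - 1) *
        (2 * (l i - l j) * crossRe i j (rotated φ V)))) ∂(haarUnitary d) = 0 := by
  refine integral_haarUnitary_deriv_eq_zero
    (fun t => ⟨planeRotation i j t, planeRotation_mem hij t⟩) ?_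
    (f := fun V => crossRe i j (rotated φ V) * diagForm l (rotated φ V) ^ n) (by fun_prop)
    (by fun_prop) ?_
  · ext1
    simp [planeRotation]
  · intro V t
    simp only [rotated_mul]
    have h1 := hasDerivAt_planeRotation_re_im hij (rotated φ V) t i
    have h2 := hasDerivAt_planeRotation_re_im hij (rotated φ V) t j
    have h3 := (h1.1.fun_mul h2.1).fun_add (h1.2.fun_mul h2.2)
    have h4 := (hasDerivAt_diagForm_planeRotation hij (rotated φ V) l t).fun_pow n
    have h5 := h3.fun_mul h4
    simp only [if_true, hij.symm, if_false] at h5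
    unfold crossRe at h5 ⊢
    generalize hg : (2 * (l i - l j) : ℝ) = c at h5 ⊢
    refine h5.congr_deriv ?_
    simp only [Complex.normSq_apply]
    ring

/-- The diagonal unitary that multiplies the coordinate `j` by `i`. -/
noncomputable def coordPhase {d : ℕ} (j : Fin d) : Unitaries d :=
  ⟨Matrix.diagonal fun k => if k = j then Complex.I else 1, by
    rw [Matrix.mem_unitaryGroup_iff, Matrix.star_eq_conjTranspose, Matrix.diagonal_conjTranspose,
      Matrix.diagonal_mul_diagonal, ← Matrix.diagonal_one]
    congr 1
    ext k
    by_cases h : k = j <;> simp [h]⟩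

/-- Multiplying coordinate `j` by the imaginary unit preserves the Haar measure and `diagForm`, but
exchanges, up to sign, the real and imaginary parts of `w i * conj (w j)`. Their squares thus have
equal averages, and they add up to `|w i|² |w j|²`. -/
lemma integral_crossRe_sq {d : ℕ} {i j : Fin d} (hij : i ≠ j) (φ : Fin d → ℂ)
    (l : Fin d → ℝ) (n : ℕ) :
    2 * ∫ V : Unitaries d, crossRe i j (rotated φ V) ^ 2 * diagForm l (rotated φ V) ^ n
        ∂(haarUnitary d) =
      ∫ V : Unitaries d, Complex.normSq (rotated φ V i) * Complex.normSq (rotated φ V j) *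
        diagForm l (rotated φ V) ^ n ∂(haarUnitary d) := by
  have hc : Continuous fun V : Unitaries d =>
      crossRe i j (rotated φ V) ^ 2 * diagForm l (rotated φ V) ^ n := by fun_prop
  have h := integral_mul_left_eq_self (μ := haarUnitary d) (fun V : Unitaries d =>
    crossRe i j (rotated φ V) ^ 2 * diagForm l (rotated φ V) ^ n) (coordPhase j)
  rw [two_mul]
  nth_rw 1 [← h]
  rw [← integral_add]
  · congr 1
    ext V
    have hk : ∀ k, rotated φ (coordPhase j * V) k =
        (if k = j then Complex.I else 1) * rotated φ V k := fun k => by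
      rw [rotated_mul, coordPhase, Matrix.mulVec_diagonal]
    have hd : diagForm l (rotated φ (coordPhase j * V)) = diagForm l (rotated φ V) := by
      unfold diagForm
      refine Finset.sum_congr rfl fun k _ => ?_
      rw [hk]
      split_ifs <;> simp
    rw [hd, crossRe, hk, hk]
    simp only [crossRe, hij, if_true, if_false, one_mul, Complex.I_mul_re, Complex.I_mul_im,
      Complex.normSq_apply]
    ring
  · exact (hc.comp (continuous_const_mul (coordPhase j))).integrable_of_compact _
  · exact hc.integrable_of_compact _

/-- The rotation identity with the cross term eliminated. At `n = 0` the truncated exponent `n - 1`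
is harmless, since the prefactor `n` vanishes. -/
lemma integral_normSq_sub_mul {d : ℕ} (i j : Fin d) (φ : Fin d → ℂ)
    (l : Fin d → ℝ) (n : ℕ) :
    ∫ V : Unitaries d, ((Complex.normSq (rotated φ V j) - Complex.normSq (rotated φ V i)) *
        diagForm l (rotated φ V) ^ n) ∂(haarUnitary d) =
      n * (l j - l i) * ∫ V : Unitaries d, Complex.normSq (rotated φ V i) *
        Complex.normSq (rotated φ V j) * diagForm l (rotated φ V) ^ (n - 1) ∂(haarUnitary d) := by
  by_cases hij : i = j
  · simp [hij]
  have h := integral_rotation_identity hij φ l n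
  rw [← integral_crossRe_sq hij]
  rw [integral_add ((by fun_prop : Continuous _).integrable_of_compact _)
    ((by fun_prop : Continuous _).integrable_of_compact _)] at h
  have h2 : ∫ V : Unitaries d, crossRe i j (rotated φ V) * (n * diagForm l (rotated φ V) ^ (n - 1) *
        (2 * (l i - l j) * crossRe i j (rotated φ V))) ∂(haarUnitary d) =
      (n * (2 * (l i - l j))) * ∫ V : Unitaries d, crossRe i j (rotated φ V) ^ 2 *
        diagForm l (rotated φ V) ^ (n - 1) ∂(haarUnitary d) := by
    rw [← integral_const_mul]
    congr 1
    ext V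
    ring
  rw [h2] at h
  linarith

lemma sum_normSq_rotated {d : ℕ} {φ : Fin d → ℂ} (hφ : ∑ k, Complex.normSq (φ k) = 1)
    (V : Unitaries d) : ∑ k, Complex.normSq (rotated φ V k) = 1 := by
  have h : ∀ w : Fin d → ℂ, ((∑ k, Complex.normSq (w k) : ℝ) : ℂ) = star w ⬝ᵥ w := fun w => by
    simp [dotProduct, Complex.normSq_eq_conj_mul_self]
  have h1 : star (rotated φ V) ⬝ᵥ rotated φ V = star φ ⬝ᵥ φ := by
    rw [rotated, Matrix.star_mulVec, Matrix.dotProduct_mulVec, Matrix.vecMul_vecMul,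
      ← Matrix.star_eq_conjTranspose, Matrix.mem_unitaryGroup_iff'.1 V.2, Matrix.vecMul_one]
  rw [← h, ← h, hφ] at h1
  exact_mod_cast h1

/-- The recursion for the Haar moments of a diagonal quadratic form. -/
lemma integral_diagForm_pow_succ {d : ℕ} {φ : Fin d → ℂ} (hφ : ∑ k, Complex.normSq (φ k) = 1)
    (l : Fin d → ℝ) (n : ℕ) :
    d * ∫ V : Unitaries d, diagForm l (rotated φ V) ^ (n + 1) ∂(haarUnitary d) -
      (∑ k, l k) * ∫ V : Unitaries d, diagForm l (rotated φ V) ^ n ∂(haarUnitary d) =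
    n * ∫ V : Unitaries d, (diagForm (fun k => l k ^ 2) (rotated φ V) -
      diagForm l (rotated φ V) ^ 2) * diagForm l (rotated φ V) ^ (n - 1) ∂(haarUnitary d) := by
  -- Weight the pair identity by `l j` and sum over all `i, j`; the normalization `∑ |w k|² = 1`
  -- then collapses both double sums.
  have h := Finset.sum_congr (rfl : (Finset.univ : Finset (Fin d)) = Finset.univ) fun i _ =>
    Finset.sum_congr (rfl : (Finset.univ : Finset (Fin d)) = Finset.univ) fun j _ =>
      congrArg (l j * ·) (integral_normSq_sub_mul i j φ l n)
  simp only [← mul_assoc, ← integral_const_mul] at h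
  have hI : ∀ f : Fin d → Fin d → Unitaries d → ℝ, (∀ i j, Continuous (f i j)) →
      ∑ i, ∑ j, ∫ V, f i j V ∂(haarUnitary d) = ∫ V, ∑ i, ∑ j, f i j V ∂(haarUnitary d) := by
    intro f hf
    rw [integral_finsetSum _ fun i _ => integrable_finsetSum _ fun j _ =>
      (hf i j).integrable_of_compact _]
    exact Finset.sum_congr rfl fun i _ =>
      (integral_finsetSum _ fun j _ => (hf i j).integrable_of_compact _).symm
  rw [hI _ (fun i j => by fun_prop), hI _ (fun i j => by fun_prop)] at h
  rw [← integral_const_mul, ← integral_const_mul, ← integral_const_mul, ← integral_sub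
    ((by fun_prop : Continuous _).integrable_of_compact _)
    ((by fun_prop : Continuous _).integrable_of_compact _)]
  refine Eq.trans ?_ (h.trans ?_)
  · congr 1
    ext V
    have h1 := sum_normSq_rotated hφ V
    have h2 : ∑ i, ∑ j, l j * (Complex.normSq (rotated φ V j) - Complex.normSq (rotated φ V i)) =
        d * diagForm l (rotated φ V) - ∑ k, l k := by
      simp only [mul_sub, Finset.sum_sub_distrib, ← Finset.sum_mul, ← Finset.mul_sum, h1]
      simp [diagForm]
    simp only [← Finset.sum_mul, h2]
    ring
  · congr 1
    ext V
    have h1 := sum_normSq_rotated hφ V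
    have h2 : ∑ i, ∑ j, l j * (l j - l i) * (Complex.normSq (rotated φ V i) *
        Complex.normSq (rotated φ V j)) =
        diagForm (fun k => l k ^ 2) (rotated φ V) - diagForm l (rotated φ V) ^ 2 := by
      have : ∀ i j, l j * (l j - l i) * (Complex.normSq (rotated φ V i) *
        Complex.normSq (rotated φ V j)) = Complex.normSq (rotated φ V i) *
          (l j ^ 2 * Complex.normSq (rotated φ V j)) - (l i * Complex.normSq (rotated φ V i)) *
          (l j * Complex.normSq (rotated φ V j)) := fun i j => by ring
      simp only [this, Finset.sum_sub_distrib, ← Finset.sum_mul, ← Finset.mul_sum, h1, diagForm]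
      ring
    rw [← h2]
    simp only [Finset.mul_sum, Finset.sum_mul]
    refine Finset.sum_congr rfl fun i _ => Finset.sum_congr rfl fun j _ => by ring

/-- The recursion at `n = 1`, with the first moments of the forms `l` and `l²` supplied by the
recursion at `n = 0`. -/
lemma integral_diagForm_sq {d : ℕ} {φ : Fin d → ℂ} (hφ : ∑ k, Complex.normSq (φ k) = 1)
    (l : Fin d → ℝ) :
    (d * (d + 1) : ℝ) * ∫ V : Unitaries d, diagForm l (rotated φ V) ^ 2 ∂(haarUnitary d) =
      ∑ k, l k ^ 2 + (∑ k, l k) ^ 2 := by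
  have h1 := integral_diagForm_pow_succ hφ l 0
  have h1' := integral_diagForm_pow_succ hφ (fun k => l k ^ 2) 0
  have h2 := integral_diagForm_pow_succ hφ l 1
  simp only [zero_add, pow_one, pow_zero, Nat.cast_zero, zero_mul, integral_const, probReal_univ,
    smul_eq_mul, mul_one, Nat.cast_one, one_mul, Nat.reduceAdd, tsub_self] at h1 h1' h2
  rw [integral_sub ((by fun_prop : Continuous _).integrable_of_compact _)
    ((by fun_prop : Continuous _).integrable_of_compact _)] at h2
  linear_combination (d : ℝ) * h2 + (∑ k, l k) * h1 + h1'

lemma integral_diagForm_pow_four_le {d : ℕ} {φ : Fin d → ℂ}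
    (hφ : ∑ k, Complex.normSq (φ k) = 1) (l : Fin d → ℝ) :
    (d : ℝ) ^ 4 * ∫ V : Unitaries d, diagForm l (rotated φ V) ^ 4 ∂(haarUnitary d) ≤
      100 * (∑ k, l k ^ 2 + (∑ k, l k) ^ 2) ^ 2 := by
  rcases Nat.eq_zero_or_pos d with rfl | hd
  · simp at hφ
  have hd1 : (1 : ℝ) ≤ d := by exact_mod_cast hd
  have hd0 : (0 : ℝ) < d := by linarith
  set s := ∑ k, l k ^ 2 with hs
  set T := ∑ k, l k with hT
  have hs0 : 0 ≤ s := Finset.sum_nonneg fun _ _ => sq_nonneg _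
  have e2 := integral_diagForm_sq hφ l
  have e2' := integral_diagForm_sq hφ (fun k => l k ^ 2)
  have e4 := integral_diagForm_pow_succ hφ l 3
  rw [← hs, ← hT] at e2
  rw [← hs] at e2'
  rw [← hT] at e4
  have hs4 : ∑ k, (l k ^ 2) ^ 2 ≤ s ^ 2 :=
    Finset.sum_sq_le_sq_sum_of_nonneg fun _ _ => sq_nonneg _
  have i4 : Integrable (fun V : Unitaries d => diagForm l (rotated φ V) ^ 4) (haarUnitary d) :=
    (by fun_prop : Continuous _).integrable_of_compact _
  have i2 : Integrable (fun V : Unitaries d => diagForm l (rotated φ V) ^ 2) (haarUnitary d) :=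
    (by fun_prop : Continuous _).integrable_of_compact _
  have i3 : Integrable (fun V : Unitaries d => diagForm l (rotated φ V) ^ 3) (haarUnitary d) :=
    (by fun_prop : Continuous _).integrable_of_compact _
  have i2' : Integrable (fun V : Unitaries d =>
      diagForm (fun k => l k ^ 2) (rotated φ V) ^ 2) (haarUnitary d) :=
    (by fun_prop : Continuous _).integrable_of_compact _
  have im : Integrable (fun V : Unitaries d => diagForm (fun k => l k ^ 2) (rotated φ V) *
      diagForm l (rotated φ V) ^ 2) (haarUnitary d) :=
    (by fun_prop : Continuous _).integrable_of_compact _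
  have e4' : ∫ V : Unitaries d, (diagForm (fun k => l k ^ 2) (rotated φ V) -
      diagForm l (rotated φ V) ^ 2) * diagForm l (rotated φ V) ^ (3 - 1) ∂(haarUnitary d) =
      ∫ V : Unitaries d, diagForm (fun k => l k ^ 2) (rotated φ V) *
      diagForm l (rotated φ V) ^ 2 ∂(haarUnitary d) -
      ∫ V : Unitaries d, diagForm l (rotated φ V) ^ 4 ∂(haarUnitary d) := by
    rw [← integral_sub im i4]
    congr 1
    ext V
    ring
  rw [e4'] at e4
  -- The recursion at `n = 3` expresses `(d + 3) M4` through `T * M3` and three times the mixed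
  -- moment. Young's inequality with these weights spends `d/2 + 3 d/8` of the coefficient of `M4`,
  -- leaving at least `d/8`; only second moments of `l` and `l²` remain.
  have b3 : T * ∫ V : Unitaries d, diagForm l (rotated φ V) ^ 3 ∂(haarUnitary d) ≤
      d / 2 * ∫ V : Unitaries d, diagForm l (rotated φ V) ^ 4 ∂(haarUnitary d) +
      T ^ 2 / (2 * d) * ∫ V : Unitaries d, diagForm l (rotated φ V) ^ 2 ∂(haarUnitary d) := by
    rw [← integral_const_mul, ← integral_const_mul, ← integral_const_mul,
      ← integral_add (i4.const_mul _) (i2.const_mul _)]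
    refine integral_mono (i3.const_mul _) ((i4.const_mul _).add (i2.const_mul _)) fun V => ?_
    set q := diagForm l (rotated φ V)
    have : d / 2 * q ^ 4 + T ^ 2 / (2 * d) * q ^ 2 - T * q ^ 3 = (d * q - T) ^ 2 * q ^ 2 / (2 * d) := by
      field_simp
      ring
    have h0 : 0 ≤ (d * q - T) ^ 2 * q ^ 2 / (2 * d) := by positivity
    simp only
    linarith
  have bm : ∫ V : Unitaries d, diagForm (fun k => l k ^ 2) (rotated φ V) *
      diagForm l (rotated φ V) ^ 2 ∂(haarUnitary d) ≤
      d / 8 * ∫ V : Unitaries d, diagForm l (rotated φ V) ^ 4 ∂(haarUnitary d) +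
      2 / d * ∫ V : Unitaries d, diagForm (fun k => l k ^ 2) (rotated φ V) ^ 2 ∂(haarUnitary d) := by
    rw [← integral_const_mul, ← integral_const_mul,
      ← integral_add (i4.const_mul _) (i2'.const_mul _)]
    refine integral_mono im ((i4.const_mul _).add (i2'.const_mul _)) fun V => ?_
    set q := diagForm l (rotated φ V)
    set r := diagForm (fun k => l k ^ 2) (rotated φ V)
    have : d / 8 * q ^ 4 + 2 / d * r ^ 2 - r * q ^ 2 = (d * q ^ 2 - 4 * r) ^ 2 / (8 * d) := by
      field_simp
      ring
    have h0 : 0 ≤ (d * q ^ 2 - 4 * r) ^ 2 / (8 * d) := by positivity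
    simp only
    linarith
  have p4 : 0 ≤ ∫ V : Unitaries d, diagForm l (rotated φ V) ^ 4 ∂(haarUnitary d) :=
    integral_nonneg fun V => by positivity
  have p2 : 0 ≤ ∫ V : Unitaries d, diagForm l (rotated φ V) ^ 2 ∂(haarUnitary d) :=
    integral_nonneg fun V => by positivity
  have p2' : 0 ≤ ∫ V : Unitaries d, diagForm (fun k => l k ^ 2) (rotated φ V) ^ 2 ∂(haarUnitary d) :=
    integral_nonneg fun V => by positivity
  simp only [Nat.reduceAdd, Nat.cast_ofNat] at e4
  generalize (∫ V : Unitaries d, diagForm l (rotated φ V) ^ 4 ∂(haarUnitary d)) = M4 at *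
  generalize (∫ V : Unitaries d, diagForm l (rotated φ V) ^ 3 ∂(haarUnitary d)) = M3 at *
  generalize (∫ V : Unitaries d, diagForm l (rotated φ V) ^ 2 ∂(haarUnitary d)) = M2 at *
  generalize (∫ V : Unitaries d, diagForm (fun k => l k ^ 2) (rotated φ V) ^ 2 ∂(haarUnitary d)) =
    M2' at *
  generalize (∫ V : Unitaries d, diagForm (fun k => l k ^ 2) (rotated φ V) *
      diagForm l (rotated φ V) ^ 2 ∂(haarUnitary d)) = Mm at *
  have q2 : (d : ℝ) ^ 2 * M2 ≤ s + T ^ 2 := by nlinarith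
  have q2' : (d : ℝ) ^ 2 * M2' ≤ 2 * s ^ 2 := by nlinarith
  have k1 : (d / 8 : ℝ) * M4 ≤ T ^ 2 / (2 * d) * M2 + 6 / d * M2' := by
    have : 3 * (2 / (d : ℝ) * M2') = 6 / d * M2' := by ring
    linarith
  have k2 : (d : ℝ) ^ 4 * M4 ≤ 4 * T ^ 2 * (d ^ 2 * M2) + 48 * (d ^ 2 * M2') := by
    have := mul_le_mul_of_nonneg_left k1 (by positivity : 0 ≤ 8 * (d : ℝ) ^ 3)
    have e : 8 * (d : ℝ) ^ 3 * (T ^ 2 / (2 * d) * M2 + 6 / d * M2') =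
      4 * T ^ 2 * (d ^ 2 * M2) + 48 * (d ^ 2 * M2') := by
      field_simp
      ring
    linarith [e]
  have k3 := mul_le_mul_of_nonneg_left q2 (by positivity : 0 ≤ 4 * T ^ 2)
  nlinarith [mul_nonneg hs0 (sq_nonneg T), sq_nonneg (T ^ 2), sq_nonneg s]

/-! ### Second and fourth moments of expectation values -/

/-- `tr (H†H) + (Re tr H)²`, which is `d (d + 1)` times the second Haar moment of the expectation
value of a Hermitian matrix `H`. -/
noncomputable def momentScale {d : ℕ} (H : Matrix (Fin d) (Fin d) ℂ) : ℝ :=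
  hsNorm H ^ 2 + H.trace.re ^ 2

lemma momentScale_nonneg {d : ℕ} (H : Matrix (Fin d) (Fin d) ℂ) : 0 ≤ momentScale H := by
  unfold momentScale; positivity

lemma sum_normSq_eq_one {d : ℕ} {φ : EuclideanSpace ℂ (Fin d)} (hφ : ‖φ‖ = 1) :
    ∑ k, Complex.normSq (φ k) = 1 := by
  have h := EuclideanSpace.norm_sq_eq φ
  rw [hφ] at h
  simp only [Complex.normSq_eq_norm_sq]
  linarith

lemma conj_pureState {d : ℕ} (φ : EuclideanSpace ℂ (Fin d)) (V : Unitaries d) :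
    V.1 * pureState φ * V.1ᴴ = Matrix.of fun i j => rotated φ V i * star (rotated φ V j) := by
  have h : pureState φ = Matrix.vecMulVec (⇑φ) (star (⇑φ)) := by
    ext i j; simp [pureState, Matrix.vecMulVec_apply]
  rw [h, Matrix.mul_vecMulVec, Matrix.vecMulVec_mul, ← Matrix.star_mulVec]
  rfl

lemma isHermitian_conj_pureState {d : ℕ} (φ : EuclideanSpace ℂ (Fin d)) (V : Unitaries d) :
    (V.1 * pureState φ * V.1ᴴ).IsHermitian := by
  rw [conj_pureState]
  ext i j
  simp [mul_comm]

lemma trace_diagonal_mul_conj_pureState {d : ℕ} (l : Fin d → ℝ) (φ : EuclideanSpace ℂ (Fin d))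
    (V : Unitaries d) : (Matrix.diagonal (fun k => (l k : ℂ)) *
      (V.1 * pureState φ * V.1ᴴ)).trace = (diagForm l (rotated φ V) : ℂ) := by
  rw [conj_pureState]
  simp only [Matrix.trace, Matrix.diag_apply, Matrix.diagonal_mul, Matrix.of_apply, diagForm,
    Complex.ofReal_sum, Complex.ofReal_mul, Complex.star_def, Complex.mul_conj]

lemma exists_diagonalization {d : ℕ} {H : Matrix (Fin d) (Fin d) ℂ} (hH : H.IsHermitian) :
    ∃ (W : Unitaries d) (l : Fin d → ℝ),
      H = W.1 * Matrix.diagonal (fun k => (l k : ℂ)) * W.1ᴴ :=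
  ⟨hH.eigenvectorUnitary, hH.eigenvalues, by
    conv_lhs => rw [hH.spectral_theorem, Unitary.conjStarAlgAut_apply]
    rfl⟩

lemma momentScale_eq {d : ℕ} (W : Unitaries d) (l : Fin d → ℝ) :
    momentScale (W.1 * Matrix.diagonal (fun k => (l k : ℂ)) * W.1ᴴ) =
      ∑ k, l k ^ 2 + (∑ k, l k) ^ 2 := by
  have hW : W.1ᴴ * W.1 = 1 := Matrix.mem_unitaryGroup_iff'.1 W.2
  have h : ∀ M : Matrix (Fin d) (Fin d) ℂ, (W.1 * M * W.1ᴴ).trace = M.trace := fun M => by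
    rw [Matrix.trace_mul_comm, ← Matrix.mul_assoc, hW, Matrix.one_mul]
  have h2 : (W.1 * Matrix.diagonal (fun k => (l k : ℂ)) * W.1ᴴ)ᴴ *
      (W.1 * Matrix.diagonal (fun k => (l k : ℂ)) * W.1ᴴ) =
      W.1 * Matrix.diagonal (fun k => ((l k ^ 2 : ℝ) : ℂ)) * W.1ᴴ := by
    simp only [Matrix.conjTranspose_mul, Matrix.conjTranspose_conjTranspose,
      Matrix.diagonal_conjTranspose]
    calc _ = W.1 * (Matrix.diagonal (star fun k => (l k : ℂ)) * (W.1ᴴ * W.1) *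
          Matrix.diagonal (fun k => (l k : ℂ))) * W.1ᴴ := by simp only [Matrix.mul_assoc]
      _ = _ := by
        rw [hW, Matrix.mul_one, Matrix.diagonal_mul_diagonal]
        congr 3
        ext k
        simp [sq]
  rw [momentScale, hsNorm_sq, ← trace_conjTranspose_mul_self_re, h2, h, h, Matrix.trace_diagonal,
    Matrix.trace_diagonal, ← Complex.ofReal_sum, ← Complex.ofReal_sum, Complex.ofReal_re,
    Complex.ofReal_re]

/-- The diagonalizing unitary of `H` is moved onto `V`, where left invariance of the Haar measure
removes it. This reduces Hermitian `H` to diagonal forms. -/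
lemma trace_mul_conj_pureState {d : ℕ} (W : Unitaries d) (l : Fin d → ℝ)
    (φ : EuclideanSpace ℂ (Fin d)) (V : Unitaries d) :
    (W.1 * Matrix.diagonal (fun k => (l k : ℂ)) * W.1ᴴ * (V.1 * pureState φ * V.1ᴴ)).trace =
      (diagForm l (rotated φ (W⁻¹ * V)) : ℂ) := by
  rw [← trace_diagonal_mul_conj_pureState]
  have h : (W⁻¹ * V).1 = W.1ᴴ * V.1 := rfl
  rw [h, Matrix.conjTranspose_mul, Matrix.conjTranspose_conjTranspose, Matrix.mul_assoc,
    Matrix.mul_assoc, Matrix.trace_mul_comm]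
  simp only [Matrix.mul_assoc]

lemma trace_mul_conj_pureState_eq_re {d : ℕ} {H : Matrix (Fin d) (Fin d) ℂ} (hH : H.IsHermitian)
    (φ : EuclideanSpace ℂ (Fin d)) (V : Unitaries d) :
    (H * (V.1 * pureState φ * V.1ᴴ)).trace =
      (((H * (V.1 * pureState φ * V.1ᴴ)).trace.re : ℝ) : ℂ) := by
  obtain ⟨W, l, rfl⟩ := exists_diagonalization hH
  rw [trace_mul_conj_pureState, Complex.ofReal_re]

lemma integral_haarUnitary_sq {d : ℕ} {H : Matrix (Fin d) (Fin d) ℂ} (hH : H.IsHermitian)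
    {φ : EuclideanSpace ℂ (Fin d)} (hφ : ‖φ‖ = 1) :
    (d * (d + 1) : ℝ) * ∫ V : Unitaries d, (H * (V.1 * pureState φ * V.1ᴴ)).trace.re ^ 2
      ∂(haarUnitary d) = momentScale H := by
  obtain ⟨W, l, rfl⟩ := exists_diagonalization hH
  simp only [trace_mul_conj_pureState, Complex.ofReal_re]
  rw [integral_mul_left_eq_self (fun V => diagForm l (rotated φ V) ^ 2), momentScale_eq,
    integral_diagForm_sq (sum_normSq_eq_one hφ)]

lemma integral_haarUnitary_pow_four_le {d : ℕ} {H : Matrix (Fin d) (Fin d) ℂ}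
    (hH : H.IsHermitian) {φ : EuclideanSpace ℂ (Fin d)} (hφ : ‖φ‖ = 1) :
    (d : ℝ) ^ 4 * ∫ V : Unitaries d, (H * (V.1 * pureState φ * V.1ᴴ)).trace.re ^ 4
      ∂(haarUnitary d) ≤ 100 * momentScale H ^ 2 := by
  obtain ⟨W, l, rfl⟩ := exists_diagonalization hH
  simp only [trace_mul_conj_pureState, Complex.ofReal_re]
  rw [integral_mul_left_eq_self (fun V => diagForm l (rotated φ V) ^ 4), momentScale_eq]
  exact integral_diagForm_pow_four_le (sum_normSq_eq_one hφ) l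

lemma hsNorm_pureState {d : ℕ} {φ : EuclideanSpace ℂ (Fin d)} (hφ : ‖φ‖ = 1) :
    hsNorm (pureState φ) = 1 := by
  rw [← sq_eq_sq₀ (hsNorm_nonneg _) zero_le_one, hsNorm_sq]
  have h := sum_normSq_eq_one hφ
  simp only [Complex.normSq_eq_norm_sq] at h
  simp [pureState, mul_pow, ← Finset.mul_sum, h]

lemma hsNorm_one {d : ℕ} : hsNorm (1 : Matrix (Fin d) (Fin d) ℂ) ^ 2 = d := by
  rw [hsNorm_sq, ← trace_conjTranspose_mul_self_re]
  simp

/-- The basis vector `e_i`. -/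
noncomputable abbrev basisVector {d : ℕ} (i : Fin d) : EuclideanSpace ℂ (Fin d) :=
  EuclideanSpace.single i 1

lemma pureState_basisVector {d : ℕ} (i : Fin d) :
    pureState (basisVector i) = Matrix.single i i 1 := by
  ext a b
  simp only [pureState, Matrix.of_apply, Matrix.single_apply, basisVector,
    PiLp.single_apply, @eq_comm _ a i, @eq_comm _ b i]
  by_cases h : i = a <;> by_cases h' : i = b <;> simp [h, h']

lemma norm_basisVector {d : ℕ} (i : Fin d) : ‖basisVector i‖ = 1 := by
  simp [basisVector]

lemma trace_conj_pureState {d : ℕ} {φ : EuclideanSpace ℂ (Fin d)} (hφ : ‖φ‖ = 1)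
    (V : Unitaries d) : (V.1 * pureState φ * V.1ᴴ).trace = 1 := by
  have h := trace_diagonal_mul_conj_pureState (fun _ => 1) φ V
  simpa [diagForm, sum_normSq_rotated (sum_normSq_eq_one hφ)] using h

/-- Turns a random measurement of `A` into the expectation of `A` in a random state, at the cost of
inverting `U`. -/
lemma trace_mul_conj_swap {d : ℕ} (P A : Matrix (Fin d) (Fin d) ℂ) (U : Unitaries d) :
    (P * (U.1 * A * U.1ᴴ)).trace = (A * ((U⁻¹).1 * P * (U⁻¹).1ᴴ)).trace := by
  have h : (U⁻¹).1 = U.1ᴴ := rfl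
  rw [h, Matrix.conjTranspose_conjTranspose, Matrix.trace_mul_comm, Matrix.mul_assoc,
    Matrix.mul_assoc, Matrix.trace_mul_comm]
  simp only [Matrix.mul_assoc]

/-- The functional has the second Haar moment up to a small relative error, and a fourth
moment of the right order. -/
structure HasDesignMoments {d : ℕ} (ν : Measure (Unitaries d)) (f : Unitaries d → ℝ) (S : ℝ) :
    Prop where
  abs_sq_sub_le : |(d * (d + 1) : ℝ) * ∫ U, f U ^ 2 ∂ν - S| ≤ S / 1000
  pow_four_le : (d : ℝ) ^ 4 * ∫ U, f U ^ 4 ∂ν ≤ 101 * S ^ 2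

lemma IsApproxDesign.abs_integral_sub_le {d : ℕ} {δ : ℝ} (hδ : 0 ≤ δ)
    {ν : Measure (Unitaries d)} [IsFiniteMeasure ν] (h : IsApproxDesign δ 4 ν)
    (O X : Fin 4 → Matrix (Fin d) (Fin d) ℂ) (f : Unitaries d → ℝ)
    (hf : ∀ U : Unitaries d, ∏ r, (O r * (U.1 * X r * U.1ᴴ)).trace = (f U : ℂ)) :
    |∫ U, f U ∂ν - ∫ U, f U ∂(haarUnitary d)| ≤
      δ * d ^ 2 * ((∏ r, hsNorm (O r)) * ∏ r, hsNorm (X r)) := by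
  have h1 := h.norm_integral_sub_le hδ O X
  simp only [hf, integral_complex_ofReal] at h1
  rw [← Complex.ofReal_sub, Complex.norm_real, Real.norm_eq_abs,
    show (d : ℝ) ^ 4 = (d ^ 2) ^ 2 by ring, Real.sqrt_sq (by positivity)] at h1
  exact h1

/-- Here `s` is a squared Hilbert-Schmidt norm. After scaling by `d (d + 1)` and `d ^ 4`, the design
errors are at most `2 δ d⁵ s` and `δ d⁶ s²`, both controlled by `hδd`. -/
lemma HasDesignMoments.of_haar {d : ℕ} (hd : 0 < d) {δ : ℝ} (hδ : 0 ≤ δ)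
    (hδd : δ * d ^ 8 ≤ 1 / 2304) {ν : Measure (Unitaries d)} {f : Unitaries d → ℝ} {S s : ℝ}
    (hs : 0 ≤ s) (hsS : s ≤ S)
    (haar2 : (d * (d + 1) : ℝ) * ∫ U, f U ^ 2 ∂(haarUnitary d) = S)
    (haar4 : (d : ℝ) ^ 4 * ∫ U, f U ^ 4 ∂(haarUnitary d) ≤ 100 * S ^ 2)
    (h2 : |∫ U, f U ^ 2 ∂ν - ∫ U, f U ^ 2 ∂(haarUnitary d)| ≤ δ * d ^ 2 * (s * d))
    (h4 : |∫ U, f U ^ 4 ∂ν - ∫ U, f U ^ 4 ∂(haarUnitary d)| ≤ δ * d ^ 2 * s ^ 2) :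
    HasDesignMoments ν f S := by
  have hd1 : (1 : ℝ) ≤ d := by exact_mod_cast hd
  have hp5 : δ * d ^ 5 ≤ 1 / 2304 := (mul_le_mul_of_nonneg_left
    (pow_le_pow_right₀ hd1 (by norm_num)) hδ).trans hδd
  have hp6 : δ * d ^ 6 ≤ 1 / 2304 := (mul_le_mul_of_nonneg_left
    (pow_le_pow_right₀ hd1 (by norm_num)) hδ).trans hδd
  constructor
  · rw [← haar2, ← mul_sub, abs_mul, abs_of_nonneg (by positivity : (0 : ℝ) ≤ d * (d + 1)), haar2]
    calc (d * (d + 1) : ℝ) * |∫ U, f U ^ 2 ∂ν - ∫ U, f U ^ 2 ∂(haarUnitary d)|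
        ≤ (d * (2 * d)) * (δ * d ^ 2 * (s * d)) := by
          gcongr
          linarith
      _ = 2 * (δ * d ^ 5) * s := by ring
      _ ≤ 2 * (1 / 2304) * S := by gcongr
      _ ≤ S / 1000 := by linarith
  · have h5 := (abs_le.1 h4).2
    have h6 : (d : ℝ) ^ 4 * (δ * d ^ 2 * s ^ 2) ≤ S ^ 2 := by
      calc (d : ℝ) ^ 4 * (δ * d ^ 2 * s ^ 2) = (δ * d ^ 6) * s ^ 2 := by ring
        _ ≤ 1 * S ^ 2 := by
          gcongr
          linarith
        _ = S ^ 2 := one_mul _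
    have h7 := mul_le_mul_of_nonneg_left h5 (by positivity : (0 : ℝ) ≤ (d : ℝ) ^ 4)
    rw [mul_sub] at h7
    linarith

lemma hsNorm_sq_le_momentScale {d : ℕ} (H : Matrix (Fin d) (Fin d) ℂ) :
    hsNorm H ^ 2 ≤ momentScale H := by
  unfold momentScale
  linarith [sq_nonneg H.trace.re]

/-- Moments of the expectation value of `H` in a randomly rotated state. -/
lemma IsApproxDesign.hasDesignMoments_state {d : ℕ} {δ : ℝ} (hδ : 0 ≤ δ)
    (hδd : δ * d ^ 8 ≤ 1 / 2304) {ν : Measure (Unitaries d)} [IsFiniteMeasure ν]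
    (h : IsApproxDesign δ 4 ν) {H : Matrix (Fin d) (Fin d) ℂ} (hH : H.IsHermitian)
    {φ : EuclideanSpace ℂ (Fin d)} (hφ : ‖φ‖ = 1) :
    HasDesignMoments ν (fun V => (H * (V.1 * pureState φ * V.1ᴴ)).trace.re) (momentScale H) := by
  rcases Nat.eq_zero_or_pos d with rfl | hd
  · have := sum_normSq_eq_one hφ
    simp at this
  refine HasDesignMoments.of_haar hd hδ hδd (sq_nonneg (hsNorm H)) (hsNorm_sq_le_momentScale H)
    (integral_haarUnitary_sq hH hφ) (integral_haarUnitary_pow_four_le hH hφ) ?_ ?_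
  -- The second moment is read off the fourth by padding with two identities: each contributes the
  -- trace one, and the norm `√d`, whence the factor `d` in the error.
  · refine (h.abs_integral_sub_le hδ ![H, H, 1, 1] (fun _ => pureState φ) _ fun V => ?_).trans ?_
    · have := trace_mul_conj_pureState_eq_re hH φ V
      simp only [Fin.prod_univ_four, Matrix.cons_val, Matrix.one_mul, trace_conj_pureState hφ]
      conv_lhs => rw [this]
      push_cast
      ring
    · simp only [Fin.prod_univ_four, Matrix.cons_val, hsNorm_pureState hφ, mul_one]
      rw [← hsNorm_one]
      exact le_of_eq (by ring)
  · refine (h.abs_integral_sub_le hδ (fun _ => H) (fun _ => pureState φ) _ fun V => ?_).trans ?_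
    · have := trace_mul_conj_pureState_eq_re hH φ V
      simp only [Finset.prod_const, Finset.card_univ, Fintype.card_fin]
      conv_lhs => rw [this]
      push_cast
      rfl
    · simp only [Fin.prod_univ_four, hsNorm_pureState hφ, mul_one]
      exact le_of_eq (by ring)

/-- Moments of the probability of an outcome of a random measurement. -/
lemma IsApproxDesign.hasDesignMoments_measurement {d : ℕ} {δ : ℝ} (hδ : 0 ≤ δ)
    (hδd : δ * d ^ 8 ≤ 1 / 2304) {ν : Measure (Unitaries d)} [IsFiniteMeasure ν]
    (h : IsApproxDesign δ 4 ν) {A : Matrix (Fin d) (Fin d) ℂ} (hA : A.IsHermitian) (i : Fin d) :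
    HasDesignMoments ν (fun U => (Matrix.single i i 1 * (U.1 * A * U.1ᴴ)).trace.re)
      (momentScale A) := by
  have hφ := norm_basisVector i
  have hreal : ∀ U : Unitaries d, (pureState (basisVector i) * (U.1 * A * U.1ᴴ)).trace =
      (((pureState (basisVector i) * (U.1 * A * U.1ᴴ)).trace.re : ℝ) : ℂ) := fun U => by
    rw [trace_mul_conj_swap]
    exact trace_mul_conj_pureState_eq_re hA _ _
  have hinv : ∀ n : ℕ, ∫ U : Unitaries d, (pureState (basisVector i) *
      (U.1 * A * U.1ᴴ)).trace.re ^ n ∂(haarUnitary d) = ∫ U : Unitaries d,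
      (A * (U.1 * pureState (basisVector i) * U.1ᴴ)).trace.re ^ n ∂(haarUnitary d) := fun n => by
    rw [← integral_haarUnitary_inv (f := fun U : Unitaries d =>
      (A * (U.1 * pureState (basisVector i) * U.1ᴴ)).trace.re ^ n)
      ((Complex.continuous_re.comp (continuous_trace_conj _ _)).pow n)]
    congr 1
    ext U
    rw [trace_mul_conj_swap]
  rw [← pureState_basisVector]
  refine HasDesignMoments.of_haar i.pos hδ hδd (sq_nonneg (hsNorm A)) (hsNorm_sq_le_momentScale A)
    ?_ ?_ ?_ ?_
  · rw [hinv, integral_haarUnitary_sq hA hφ]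
  · rw [hinv]
    exact integral_haarUnitary_pow_four_le hA hφ
  · refine (h.abs_integral_sub_le hδ (fun _ => pureState (basisVector i)) ![A, A, 1, 1] _
      fun U => ?_).trans ?_
    · have h1 : (pureState (basisVector i) * (U.1 * 1 * U.1ᴴ)).trace = 1 := by
        have hU : U.1 * U.1ᴴ = 1 := Matrix.mem_unitaryGroup_iff.1 U.2
        rw [Matrix.mul_one, hU, Matrix.mul_one, pureState_basisVector, Matrix.trace_single_eq_same]
      simp only [Fin.prod_univ_four, Matrix.cons_val, h1]
      conv_lhs => rw [hreal]
      push_cast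
      ring
    · simp only [Fin.prod_univ_four, Matrix.cons_val, hsNorm_pureState hφ, mul_one, one_mul]
      rw [← hsNorm_one]
      exact le_of_eq (by ring)
  · refine (h.abs_integral_sub_le hδ (fun _ => pureState (basisVector i)) (fun _ => A) _
      fun U => ?_).trans ?_
    · simp only [Finset.prod_const, Finset.card_univ, Fintype.card_fin]
      conv_lhs => rw [hreal]
      push_cast
      rfl
    · simp only [Fin.prod_univ_four, hsNorm_pureState hφ, one_mul]
      exact le_of_eq (by ring)

/-- Moments of a sum of squares. -/
lemma HasDesignMoments.sum_sq {d : ℕ} (hd : 0 < d) {ν : Measure (Unitaries d)} [IsFiniteMeasure ν]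
    {ι : Type*} [Fintype ι] {f : ι → Unitaries d → ℝ} {S : ι → ℝ} (hf : ∀ j, Continuous (f j))
    (hS : ∀ j, 0 ≤ S j) (hS0 : ∀ j, S j = 0 → f j = 0)
    (h : ∀ j, HasDesignMoments ν (f j) (S j)) :
    |(d * (d + 1) : ℝ) * ∫ U, ∑ j, f j U ^ 2 ∂ν - ∑ j, S j| ≤ (∑ j, S j) / 1000 ∧
      (d : ℝ) ^ 4 * ∫ U, (∑ j, f j U ^ 2) ^ 2 ∂ν ≤ 101 * (∑ j, S j) ^ 2 := by
  have hd0 : (0 : ℝ) < d := by exact_mod_cast hd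
  have hi : ∀ (j : ι) (n : ℕ), Integrable (fun U => f j U ^ n) ν := fun j n =>
    ((hf j).pow n).integrable_of_compact ν
  constructor
  · rw [integral_finsetSum _ fun j _ => hi j 2, Finset.mul_sum, ← Finset.sum_sub_distrib,
      Finset.sum_div]
    exact (Finset.abs_sum_le_sum_abs _ _).trans (Finset.sum_le_sum fun j _ => (h j).abs_sq_sub_le)
  · have hpt : ∀ U, (∑ j, f j U ^ 2) ^ 2 ≤ (∑ j, S j) * ∑ j, f j U ^ 4 / S j := by
      intro U
      refine Finset.sum_sq_le_sum_mul_sum_of_sq_le_mul _ (fun j _ => hS j)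
        (fun j _ => div_nonneg (by positivity) (hS j)) fun j _ => ?_
      rcases eq_or_ne (S j) 0 with h0 | h0
      · simp [h0, hS0 j h0]
      · exact le_of_eq (by field_simp)
    have h1 : ∫ U, (∑ j, f j U ^ 2) ^ 2 ∂ν ≤ ∫ U, (∑ j, S j) * ∑ j, f j U ^ 4 / S j ∂ν :=
      integral_mono ((by fun_prop : Continuous _).integrable_of_compact ν)
        ((integrable_finsetSum _ fun j _ => (hi j 4).div_const _).const_mul _) hpt
    rw [integral_const_mul, integral_finsetSum _ fun j _ => (hi j 4).div_const _] at h1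
    simp only [integral_div] at h1
    have h2 : (d : ℝ) ^ 4 * ∑ j, (∫ U, f j U ^ 4 ∂ν) / S j ≤ 101 * ∑ j, S j := by
      rw [Finset.mul_sum, Finset.mul_sum]
      refine Finset.sum_le_sum fun j _ => ?_
      rcases (hS j).eq_or_lt with h0 | h0
      · simp [← h0]
      · rw [← mul_div_assoc, div_le_iff₀ h0]
        linarith [(h j).pow_four_le]
    calc (d : ℝ) ^ 4 * ∫ U, (∑ j, f j U ^ 2) ^ 2 ∂ν
        ≤ d ^ 4 * ((∑ j, S j) * ∑ j, (∫ U, f j U ^ 4 ∂ν) / S j) := by gcongr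
      _ = (∑ j, S j) * (d ^ 4 * ∑ j, (∫ U, f j U ^ 4 ∂ν) / S j) := by ring
      _ ≤ (∑ j, S j) * (101 * ∑ j, S j) :=
        mul_le_mul_of_nonneg_left h2 (Finset.sum_nonneg fun j _ => hS j)
      _ = 101 * (∑ j, S j) ^ 2 := by ring

/-! ### First absolute moments -/

/-- Integrate `|x| ≤ x² / (2 t) + t / 2` and take `t = s`, or let `t` tend to zero if `s = 0`. This
gives `(c + 1) s / 2`, which is at most `c s` as `1 ≤ c`. -/
lemma integral_abs_le_of_integral_sq_le {Ω : Type*} [MeasurableSpace Ω] {P : Measure Ω}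
    [IsProbabilityMeasure P] {x : Ω → ℝ} (h1 : Integrable x P) (h2 : Integrable (fun ω => x ω ^ 2) P)
    {s c : ℝ} (hs : 0 ≤ s) (hc : 1 ≤ c) (h : ∫ ω, x ω ^ 2 ∂P ≤ c * s ^ 2) :
    ∫ ω, |x ω| ∂P ≤ c * s := by
  have key : ∀ t : ℝ, 0 < t → ∫ ω, |x ω| ∂P ≤ (∫ ω, x ω ^ 2 ∂P) / (2 * t) + t / 2 := by
    intro t ht
    have h3 : ∫ ω, |x ω| ∂P ≤ ∫ ω, (x ω ^ 2 / (2 * t) + t / 2) ∂P := by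
      refine integral_mono h1.abs ((h2.div_const _).add (integrable_const _)) fun ω => ?_
      have h4 : x ω ^ 2 / (2 * t) + t / 2 - |x ω| = (|x ω| - t) ^ 2 / (2 * t) := by
        rw [← sq_abs (x ω)]
        field_simp
        ring
      have h5 : 0 ≤ (|x ω| - t) ^ 2 / (2 * t) := by positivity
      simp only
      linarith
    rw [integral_add (h2.div_const _) (integrable_const _), integral_div] at h3
    simpa using h3
  rcases hs.eq_or_lt with h0 | h0
  · subst h0
    refine le_of_forall_pos_le_add fun t ht => ?_
    have h3 := key t ht
    have h4 : (∫ ω, x ω ^ 2 ∂P) / (2 * t) ≤ 0 :=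
      div_nonpos_of_nonpos_of_nonneg (by linarith) (by positivity)
    linarith
  · have h3 := key s h0
    have h4 : (∫ ω, x ω ^ 2 ∂P) / (2 * s) ≤ c * s / 2 := by
      rw [div_le_iff₀ (by positivity)]
      linarith
    nlinarith

/-- Integrates the pointwise bound `y ≥ y² / t - y⁴ / (4 t³)` for `y ≥ 0`: a small fourth moment
forces the second moment to come from values of `|x|` that are not too large. -/
lemma le_integral_abs_of_moments {Ω : Type*} [MeasurableSpace Ω] {P : Measure Ω}
    {x : Ω → ℝ} (h1 : Integrable x P) (h2 : Integrable (fun ω => x ω ^ 2) P)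
    (h4 : Integrable (fun ω => x ω ^ 4) P) {t : ℝ} (ht : 0 < t) :
    (∫ ω, x ω ^ 2 ∂P) / t - (∫ ω, x ω ^ 4 ∂P) / (4 * t ^ 3) ≤ ∫ ω, |x ω| ∂P := by
  rw [← integral_div, ← integral_div, ← integral_sub (h2.div_const _) (h4.div_const _)]
  refine integral_mono ((h2.div_const _).sub (h4.div_const _)) h1.abs fun ω => ?_
  simp only
  have hy := abs_nonneg (x ω)
  rw [← sq_abs (x ω), show x ω ^ 4 = |x ω| ^ 4 by rw [pow_abs]; exact (abs_of_nonneg (by positivity)).symm]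
  generalize |x ω| = y at *
  have e : y - (y ^ 2 / t - y ^ 4 / (4 * t ^ 3)) =
      y * (4 * t ^ 3 - 4 * t ^ 2 * y + y ^ 3) / (4 * t ^ 3) := by
    field_simp
    ring
  -- With `u = y / t` this is `u³ - 4 u + 4`, positive at its minimizer `2 / √3` on the half-line;
  -- `7 / 6` approximates that point.
  have h : 0 ≤ 4 * t ^ 3 - 4 * t ^ 2 * y + y ^ 3 := by
    nlinarith [mul_nonneg hy (sq_nonneg (y - 3 / 2 * t)), mul_nonneg ht.le (sq_nonneg (y - t)),
      mul_nonneg ht.le (sq_nonneg (y - 7 / 6 * t)), mul_nonneg hy (sq_nonneg (y - 7 / 6 * t)), pow_pos ht 3]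
  have : 0 ≤ y * (4 * t ^ 3 - 4 * t ^ 2 * y + y ^ 3) / (4 * t ^ 3) := by positivity
  linarith

/-! ### Differences of quantum channels -/

lemma pureState_posSemidef {d : ℕ} (φ : EuclideanSpace ℂ (Fin d)) : (pureState φ).PosSemidef := by
  have h : pureState φ = Matrix.vecMulVec (⇑φ) (star (⇑φ)) := by
    ext i j; simp [pureState, Matrix.vecMulVec_apply]
  rw [h]
  exact Matrix.posSemidef_vecMulVec_self_star _

lemma IsQuantumChannel.posSemidef {d : ℕ}
    {Λ : Matrix (Fin d) (Fin d) ℂ →ₗ[ℂ] Matrix (Fin d) (Fin d) ℂ} (hΛ : IsQuantumChannel Λ)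
    {X : Matrix (Fin d) (Fin d) ℂ} (hX : X.PosSemidef) : (Λ X).PosSemidef := by
  have h := (hΛ.completelyPositive 1 _ (hX.submatrix (Prod.fst : Fin d × Fin 1 → Fin d))).submatrix
    (fun i : Fin d => (i, (0 : Fin 1)))
  exact h

lemma IsQuantumChannel.isHermitian_sub {d : ℕ}
    {Λ Γ : Matrix (Fin d) (Fin d) ℂ →ₗ[ℂ] Matrix (Fin d) (Fin d) ℂ} (hΛ : IsQuantumChannel Λ)
    (hΓ : IsQuantumChannel Γ) {X : Matrix (Fin d) (Fin d) ℂ} (hX : X.PosSemidef) :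
    ((Λ - Γ) X).IsHermitian :=
  (hΛ.posSemidef hX).1.sub (hΓ.posSemidef hX).1

/-- The matrix `B` with `tr (B Y) = Φ(Y) a b` for all `Y`. -/
noncomputable def entryFunctional {d : ℕ} (Φ : Matrix (Fin d) (Fin d) ℂ →ₗ[ℂ] Matrix (Fin d) (Fin d) ℂ)
    (a b : Fin d) : Matrix (Fin d) (Fin d) ℂ :=
  Matrix.of fun j i => Φ (Matrix.single i j 1) a b

lemma trace_entryFunctional_mul {d : ℕ}
    (Φ : Matrix (Fin d) (Fin d) ℂ →ₗ[ℂ] Matrix (Fin d) (Fin d) ℂ) (a b : Fin d)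
    (Y : Matrix (Fin d) (Fin d) ℂ) : (entryFunctional Φ a b * Y).trace = Φ Y a b := by
  conv_rhs => rw [Matrix.matrix_eq_sum_single Y]
  have h : ∀ i j, Matrix.single i j (Y i j) = Y i j • Matrix.single i j (1 : ℂ) := fun i j => by
    rw [Matrix.smul_single, smul_eq_mul, mul_one]
  simp only [h, map_sum, map_smul, Matrix.sum_apply, Matrix.smul_apply, smul_eq_mul, Matrix.trace,
    Matrix.diag_apply, Matrix.mul_apply, entryFunctional, Matrix.of_apply]
  rw [Finset.sum_comm]
  exact Finset.sum_congr rfl fun i _ => Finset.sum_congr rfl fun j _ => mul_comm _ _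

/-- The Hermitian part of a matrix. -/
noncomputable def hermitianPart {d : ℕ} (B : Matrix (Fin d) (Fin d) ℂ) :
    Matrix (Fin d) (Fin d) ℂ := (1 / 2 : ℂ) • (B + Bᴴ)

lemma isHermitian_hermitianPart {d : ℕ} (B : Matrix (Fin d) (Fin d) ℂ) :
    (hermitianPart B).IsHermitian := by
  unfold hermitianPart
  rw [Matrix.IsHermitian, Matrix.conjTranspose_smul, Matrix.conjTranspose_add,
    Matrix.conjTranspose_conjTranspose, add_comm]
  simp

lemma trace_hermitianPart_mul {d : ℕ} (B : Matrix (Fin d) (Fin d) ℂ)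
    {Y : Matrix (Fin d) (Fin d) ℂ} (hY : Y.IsHermitian) :
    (hermitianPart B * Y).trace.re = (B * Y).trace.re := by
  have h : (Bᴴ * Y).trace = star (B * Y).trace := by
    rw [← Matrix.trace_conjTranspose, Matrix.conjTranspose_mul, hY.eq, Matrix.trace_mul_comm]
  rw [hermitianPart, Matrix.smul_mul, Matrix.add_mul, Matrix.trace_smul, Matrix.trace_add, h]
  simp [Complex.add_re, Complex.add_im]
  ring

/-- Write `B = H + i K` with `H`, `K` Hermitian; these are the two Hermitian parts here, and the
cross terms cancel. Against a Hermitian `Y` they give the real and imaginary parts of `tr (B Y)`, so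
a complex functional splits into two to which the Hermitian moment bounds apply. -/
lemma momentScale_hermitianPart_add {d : ℕ} (B : Matrix (Fin d) (Fin d) ℂ) :
    momentScale (hermitianPart B) + momentScale (hermitianPart (-Complex.I • B)) =
      hsNorm B ^ 2 + ‖B.trace‖ ^ 2 := by
  have h1 : ∀ C : Matrix (Fin d) (Fin d) ℂ, (hermitianPart C).trace.re = C.trace.re := fun C => by
    simpa using trace_hermitianPart_mul C Matrix.isHermitian_one
  have h2 : hsNorm (hermitianPart B) ^ 2 + hsNorm (hermitianPart (-Complex.I • B)) ^ 2 =
      hsNorm B ^ 2 := by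
    have h3 : ∀ i j, ‖hermitianPart B i j‖ ^ 2 + ‖hermitianPart (-Complex.I • B) i j‖ ^ 2 =
        (‖B i j‖ ^ 2 + ‖B j i‖ ^ 2) / 2 := fun i j => by
      simp only [hermitianPart, Matrix.smul_apply, Matrix.add_apply, Matrix.conjTranspose_apply,
        smul_eq_mul, ← Complex.normSq_eq_norm_sq, Complex.normSq_apply]
      simp [Complex.add_re, Complex.add_im]
      ring
    rw [hsNorm_sq, hsNorm_sq, hsNorm_sq, ← Finset.sum_add_distrib]
    simp only [← Finset.sum_add_distrib, h3]
    simp only [← Finset.sum_div, Finset.sum_add_distrib]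
    rw [Finset.sum_comm (f := fun i j => ‖B j i‖ ^ 2)]
    ring
  unfold momentScale
  rw [h1, h1, ← h2, ← Complex.normSq_eq_norm_sq, Complex.normSq_apply, Matrix.trace_smul]
  simp
  ring

lemma ampliate_maxEntangled_apply {d : ℕ}
    (Φ : Matrix (Fin d) (Fin d) ℂ →ₗ[ℂ] Matrix (Fin d) (Fin d) ℂ) (a i b j : Fin d) :
    ampliate (Fin d) Φ (maxEntangled d) (a, i) (b, j) =
      (d : ℂ)⁻¹ * Φ (Matrix.single i j 1) a b := by
  have h : (Matrix.of fun k l => maxEntangled d (k, i) (l, j)) =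
      (d : ℂ)⁻¹ • Matrix.single i j (1 : ℂ) := by
    ext k l
    simp only [maxEntangled, Matrix.of_apply, Matrix.smul_apply, Matrix.single_apply, smul_eq_mul,
      mul_ite, mul_one, mul_zero, @eq_comm _ i, @eq_comm _ j]
  rw [ampliate, Matrix.of_apply, h, map_smul, Matrix.smul_apply, smul_eq_mul]

lemma choiState_sub_apply {d : ℕ}
    (Λ Γ : Matrix (Fin d) (Fin d) ℂ →ₗ[ℂ] Matrix (Fin d) (Fin d) ℂ) (a i b j : Fin d) :
    (choiState Λ - choiState Γ) (a, i) (b, j) =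
      (d : ℂ)⁻¹ * (Λ - Γ) (Matrix.single i j 1) a b := by
  rw [Matrix.sub_apply, choiState, choiState, ampliate_maxEntangled_apply,
    ampliate_maxEntangled_apply, LinearMap.sub_apply, Matrix.sub_apply, mul_sub]

/-- The total moment scale of the real and imaginary parts of the entries of `(Λ - Γ)[ψ]`. -/
lemma sum_entryFunctional_eq {d : ℕ} (hd : 0 < d)
    {Λ Γ : Matrix (Fin d) (Fin d) ℂ →ₗ[ℂ] Matrix (Fin d) (Fin d) ℂ} (hΛ : IsQuantumChannel Λ)
    (hΓ : IsQuantumChannel Γ) :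
    ∑ a, ∑ b, (hsNorm (entryFunctional (Λ - Γ) a b) ^ 2 +
      ‖(entryFunctional (Λ - Γ) a b).trace‖ ^ 2) =
      4 * (d : ℝ) ^ 2 * averageCaseDistance Λ Γ ^ 2 := by
  have hd0 : (d : ℝ) ≠ 0 := by exact_mod_cast hd.ne'
  have hτ : (maxMixed d).PosSemidef := by
    have h : (maxMixed d) = (d : ℂ)⁻¹ • (1 : Matrix (Fin d) (Fin d) ℂ) := rfl
    rw [h]
    exact Matrix.PosSemidef.one.smul (by positivity)
  have h1 : hsNorm (choiState Λ - choiState Γ) ^ 2 =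
      ((d : ℝ) ^ 2)⁻¹ * ∑ a, ∑ b, hsNorm (entryFunctional (Λ - Γ) a b) ^ 2 := by
    simp only [hsNorm_sq, Fintype.sum_prod_type, choiState_sub_apply, entryFunctional,
      Matrix.of_apply, norm_mul, mul_pow, norm_inv, Complex.norm_natCast, inv_pow,
      ← Finset.mul_sum]
    refine congrArg _ (Finset.sum_congr rfl fun a _ => ?_)
    rw [Finset.sum_comm]
    exact Finset.sum_congr rfl fun b _ => Finset.sum_comm
  -- The trace of `entryFunctional` is an entry of `(Λ - Γ)[1]`, which is `d` times `(Λ - Γ)[τ_d]`;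
  -- Hermiticity turns the trace of the square into a sum of squared entries.
  have h2 : (((Λ - Γ) (maxMixed d)) ^ 2).trace.re =
      ((d : ℝ) ^ 2)⁻¹ * ∑ a, ∑ b, ‖(entryFunctional (Λ - Γ) a b).trace‖ ^ 2 := by
    have hH := hΛ.isHermitian_sub hΓ hτ
    rw [pow_two, show (Λ - Γ) (maxMixed d) * (Λ - Γ) (maxMixed d) =
      ((Λ - Γ) (maxMixed d))ᴴ * (Λ - Γ) (maxMixed d) by rw [hH.eq],
      trace_conjTranspose_mul_self_re]
    have h3 : ∀ a b, (entryFunctional (Λ - Γ) a b).trace = (Λ - Γ) 1 a b := fun a b => by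
      simpa using trace_entryFunctional_mul (Λ - Γ) a b 1
    simp only [h3, Finset.mul_sum]
    refine Finset.sum_congr rfl fun a _ => Finset.sum_congr rfl fun b _ => ?_
    rw [maxMixed, map_smul, Matrix.smul_apply, smul_eq_mul, norm_mul, norm_inv,
      Complex.norm_natCast, mul_pow, inv_pow]
  have h4 : 0 ≤ hsNorm (choiState Λ - choiState Γ) ^ 2 +
      (((Λ - Γ) (maxMixed d)) ^ 2).trace.re := by
    rw [h1, h2]
    positivity
  rw [averageCaseDistance, mul_pow, Real.sq_sqrt h4, h1, h2]
  simp only [Finset.sum_add_distrib]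
  field_simp
  ring

lemma continuous_conj_pureState {d : ℕ} (φ : EuclideanSpace ℂ (Fin d)) :
    Continuous fun V : Unitaries d => V.1 * pureState φ * V.1ᴴ := by
  have h : Continuous fun U : Unitaries d => U.1 := continuous_subtype_val
  exact (h.matrix_mul continuous_const).matrix_mul h.matrix_conjTranspose

/-- Moments of the purity of `(Λ - Γ)[ψ]` for a random pure state `ψ`. -/
lemma IsApproxDesign.moments_hsNorm_sub {d : ℕ} {δ : ℝ} (hδ : 0 ≤ δ)
    (hδd : δ * d ^ 8 ≤ 1 / 2304) {ν : Measure (Unitaries d)} [IsFiniteMeasure ν]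
    (h : IsApproxDesign δ 4 ν)
    {Λ Γ : Matrix (Fin d) (Fin d) ℂ →ₗ[ℂ] Matrix (Fin d) (Fin d) ℂ} (hΛ : IsQuantumChannel Λ)
    (hΓ : IsQuantumChannel Γ) (hd : 0 < d) {φ : EuclideanSpace ℂ (Fin d)} (hφ : ‖φ‖ = 1) :
    |(d * (d + 1) : ℝ) * ∫ V : Unitaries d,
        hsNorm ((Λ - Γ) (V.1 * pureState φ * V.1ᴴ)) ^ 2 ∂ν -
      4 * (d : ℝ) ^ 2 * averageCaseDistance Λ Γ ^ 2| ≤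
        4 * (d : ℝ) ^ 2 * averageCaseDistance Λ Γ ^ 2 / 1000 ∧
    (d : ℝ) ^ 4 * ∫ V : Unitaries d,
        (hsNorm ((Λ - Γ) (V.1 * pureState φ * V.1ᴴ)) ^ 2) ^ 2 ∂ν ≤
      101 * (4 * (d : ℝ) ^ 2 * averageCaseDistance Λ Γ ^ 2) ^ 2 := by
  -- One observable for the real part (`false`) and one for the imaginary part (`true`) of each
  -- entry of `(Λ - Γ)[ψ]`.
  let K : (Fin d × Fin d) × Bool → Matrix (Fin d) (Fin d) ℂ := fun j =>
    hermitianPart (if j.2 then -Complex.I • entryFunctional (Λ - Γ) j.1.1 j.1.2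
      else entryFunctional (Λ - Γ) j.1.1 j.1.2)
  let f : (Fin d × Fin d) × Bool → Unitaries d → ℝ := fun j V =>
    (K j * (V.1 * pureState φ * V.1ᴴ)).trace.re
  have hS : ∑ j, momentScale (K j) = 4 * (d : ℝ) ^ 2 * averageCaseDistance Λ Γ ^ 2 := by
    rw [← sum_entryFunctional_eq hd hΛ hΓ]
    simp only [Fintype.sum_prod_type, Fintype.sum_bool, K, if_true, Bool.false_eq_true, if_false]
    refine Finset.sum_congr rfl fun a _ => Finset.sum_congr rfl fun b _ => ?_
    rw [add_comm, momentScale_hermitianPart_add]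
  have hf : ∀ V : Unitaries d, ∑ j, f j V ^ 2 =
      hsNorm ((Λ - Γ) (V.1 * pureState φ * V.1ᴴ)) ^ 2 := by
    intro V
    simp only [Fintype.sum_prod_type, Fintype.sum_bool, K, f, if_true, Bool.false_eq_true, if_false,
      trace_hermitianPart_mul _ (isHermitian_conj_pureState φ V), hsNorm_sq, Matrix.smul_mul,
      Matrix.trace_smul, trace_entryFunctional_mul]
    refine Finset.sum_congr rfl fun a _ => Finset.sum_congr rfl fun b _ => ?_
    rw [← Complex.normSq_eq_norm_sq, Complex.normSq_apply]
    simp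
    ring
  have key := HasDesignMoments.sum_sq hd (ν := ν) (f := f) (S := fun j => momentScale (K j))
    (fun j => Complex.continuous_re.comp (continuous_trace_conj _ _))
    (fun j => momentScale_nonneg _) (fun j hj => ?_)
    (fun j => h.hasDesignMoments_state hδ hδd (isHermitian_hermitianPart _) hφ)
  · simpa only [hS, hf] using key
  · ext V
    have h0 : hsNorm (K j) = 0 := by
      have := hsNorm_sq_le_momentScale (K j)
      exact pow_eq_zero_iff two_ne_zero |>.1 (le_antisymm (this.trans hj.le) (sq_nonneg _))
    have h1 := (Complex.abs_re_le_norm _).trans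
      (norm_trace_mul_le (K j) (V.1 * pureState φ * V.1ᴴ))
    rw [h0, zero_mul] at h1
    exact abs_nonpos_iff.1 h1

/-! ### Moments of the outcome differences and the final comparison. -/

/-- The difference of the outcome probabilities. -/
noncomputable def outcomeDiff {d : ℕ}
    (Λ Γ : Matrix (Fin d) (Fin d) ℂ →ₗ[ℂ] Matrix (Fin d) (Fin d) ℂ)
    (φ : EuclideanSpace ℂ (Fin d)) (i : Fin d) (W : Unitaries d × Unitaries d) : ℝ :=
  (Matrix.single i i 1 * (W.2.1 * (Λ - Γ) (W.1.1 * pureState φ * W.1.1ᴴ) * W.2.1ᴴ)).trace.re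

lemma outcomeProb_sub {d : ℕ}
    (Λ Γ : Matrix (Fin d) (Fin d) ℂ →ₗ[ℂ] Matrix (Fin d) (Fin d) ℂ)
    (φ : EuclideanSpace ℂ (Fin d)) (i : Fin d) (V U : Unitaries d) :
    outcomeProb Λ (pureState φ) V U i - outcomeProb Γ (pureState φ) V U i =
      outcomeDiff Λ Γ φ i (V, U) := by
  simp only [outcomeProb, outcomeDiff, LinearMap.sub_apply, Matrix.mul_sub, Matrix.sub_mul,
    Matrix.trace_sub, Complex.sub_re]

lemma continuous_sub_conj {d : ℕ} (Φ : Matrix (Fin d) (Fin d) ℂ →ₗ[ℂ] Matrix (Fin d) (Fin d) ℂ)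
    (φ : EuclideanSpace ℂ (Fin d)) :
    Continuous fun V : Unitaries d => Φ (V.1 * pureState φ * V.1ᴴ) :=
  Φ.continuous_of_finiteDimensional.comp (continuous_conj_pureState φ)

lemma continuous_outcomeDiff {d : ℕ}
    (Λ Γ : Matrix (Fin d) (Fin d) ℂ →ₗ[ℂ] Matrix (Fin d) (Fin d) ℂ)
    (φ : EuclideanSpace ℂ (Fin d)) (i : Fin d) : Continuous (outcomeDiff Λ Γ φ i) := by
  have h2 : Continuous fun W : Unitaries d × Unitaries d => W.2.1 :=
    continuous_subtype_val.comp continuous_snd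
  have h1 : Continuous fun W : Unitaries d × Unitaries d =>
      (Λ - Γ) (W.1.1 * pureState φ * W.1.1ᴴ) :=
    (continuous_sub_conj (Λ - Γ) φ).comp continuous_fst
  exact Complex.continuous_re.comp (continuous_const.matrix_mul
    ((h2.matrix_mul h1).matrix_mul h2.matrix_conjTranspose)).matrix_trace

lemma continuous_hsNorm_sub {d : ℕ}
    (Φ : Matrix (Fin d) (Fin d) ℂ →ₗ[ℂ] Matrix (Fin d) (Fin d) ℂ)
    (φ : EuclideanSpace ℂ (Fin d)) :
    Continuous fun V : Unitaries d => hsNorm (Φ (V.1 * pureState φ * V.1ᴴ)) ^ 2 := by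
  simp only [hsNorm_sq]
  exact continuous_finsetSum _ fun a _ => continuous_finsetSum _ fun b _ =>
    ((continuous_sub_conj Φ φ).matrix_elem a b).norm.pow 2

lemma averageTV_eq {d : ℕ} (ν : Measure (Unitaries d)) [IsProbabilityMeasure ν]
    (φ : EuclideanSpace ℂ (Fin d))
    (Λ Γ : Matrix (Fin d) (Fin d) ℂ →ₗ[ℂ] Matrix (Fin d) (Fin d) ℂ) :
    averageTV ν φ Λ Γ = 1 / 2 * ∑ i, ∫ W, |outcomeDiff Λ Γ φ i W| ∂(ν.prod ν) := by
  have hi : ∀ i, Integrable (fun W => |outcomeDiff Λ Γ φ i W|) (ν.prod ν) := fun i =>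
    (continuous_outcomeDiff Λ Γ φ i).abs.integrable_of_compact _
  rw [← integral_finsetSum _ fun i _ => hi i, ← integral_const_mul, integral_prod]
  · simp only [averageTV, tvDist, outcomeProb_sub]
  · exact (integrable_finsetSum _ fun i _ => hi i).const_mul _

/-- The second and fourth moments of the difference of the outcome probabilities. -/
lemma IsApproxDesign.moments_outcomeDiff {d : ℕ} {δ : ℝ} (hδ : 0 ≤ δ)
    (hδd : δ * d ^ 8 ≤ 1 / 2304) {ν : Measure (Unitaries d)} [IsProbabilityMeasure ν]
    (h : IsApproxDesign δ 4 ν)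
    {Λ Γ : Matrix (Fin d) (Fin d) ℂ →ₗ[ℂ] Matrix (Fin d) (Fin d) ℂ} (hΛ : IsQuantumChannel Λ)
    (hΓ : IsQuantumChannel Γ) {φ : EuclideanSpace ℂ (Fin d)} (hφ : ‖φ‖ = 1) (i : Fin d) :
    0.99 * (4 * averageCaseDistance Λ Γ ^ 2) ≤
      (d + 1 : ℝ) ^ 2 * ∫ W, outcomeDiff Λ Γ φ i W ^ 2 ∂(ν.prod ν) ∧
    (d + 1 : ℝ) ^ 2 * ∫ W, outcomeDiff Λ Γ φ i W ^ 2 ∂(ν.prod ν) ≤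
      1.01 * (4 * averageCaseDistance Λ Γ ^ 2) ∧
    (d : ℝ) ^ 4 * ∫ W, outcomeDiff Λ Γ φ i W ^ 4 ∂(ν.prod ν) ≤
      101 ^ 2 * (4 * averageCaseDistance Λ Γ ^ 2) ^ 2 := by
  have hd0 : (0 : ℝ) < d := by exact_mod_cast i.pos
  set D := averageCaseDistance Λ Γ
  set F : Unitaries d → ℝ := fun V => hsNorm ((Λ - Γ) (V.1 * pureState φ * V.1ᴴ)) ^ 2 with hF
  obtain ⟨m1, m2⟩ := h.moments_hsNorm_sub hδ hδd hΛ hΓ i.pos hφ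
  -- Trace preservation makes the difference traceless, so only the Hilbert-Schmidt term of
  -- `momentScale` survives.
  have hscale : ∀ V : Unitaries d,
      momentScale ((Λ - Γ) (V.1 * pureState φ * V.1ᴴ)) = F V := by
    intro V
    rw [momentScale, LinearMap.sub_apply, Matrix.trace_sub, hΛ.tracePreserving,
      hΓ.tracePreserving]
    simp [hF]
  have hU : ∀ V, HasDesignMoments ν (fun U => outcomeDiff Λ Γ φ i (V, U)) (F V) := fun V => by
    rw [← hscale]
    exact h.hasDesignMoments_measurement hδ hδd (hΛ.isHermitian_sub hΓ
      ((pureState_posSemidef φ).mul_mul_conjTranspose_same V.1)) i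
  have hx := continuous_outcomeDiff Λ Γ φ i
  have hFc : Continuous F := continuous_hsNorm_sub (Λ - Γ) φ
  have iF : Integrable F ν := hFc.integrable_of_compact ν
  have iF2 : Integrable (fun V => F V ^ 2) ν := (hFc.pow 2).integrable_of_compact ν
  have i2 : Integrable (fun W => outcomeDiff Λ Γ φ i W ^ 2) (ν.prod ν) :=
    (hx.pow 2).integrable_of_compact _
  have i4 : Integrable (fun W => outcomeDiff Λ Γ φ i W ^ 4) (ν.prod ν) :=
    (hx.pow 4).integrable_of_compact _
  rw [integral_prod _ i2, integral_prod _ i4]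
  have a1 : (1 - 1 / 1000) * ∫ V, F V ∂ν ≤
      (d * (d + 1) : ℝ) * ∫ V, ∫ U, outcomeDiff Λ Γ φ i (V, U) ^ 2 ∂ν ∂ν := by
    rw [← integral_const_mul, ← integral_const_mul]
    refine integral_mono (iF.const_mul _) (i2.integral_prod_left.const_mul _) fun V => ?_
    have := (abs_le.1 (hU V).abs_sq_sub_le).1
    simp only
    linarith
  have a2 : (d * (d + 1) : ℝ) * ∫ V, ∫ U, outcomeDiff Λ Γ φ i (V, U) ^ 2 ∂ν ∂ν ≤
      (1 + 1 / 1000) * ∫ V, F V ∂ν := by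
    rw [← integral_const_mul, ← integral_const_mul]
    refine integral_mono (i2.integral_prod_left.const_mul _) (iF.const_mul _) fun V => ?_
    have := (abs_le.1 (hU V).abs_sq_sub_le).2
    simp only
    linarith
  have a4 : (d : ℝ) ^ 4 * ∫ V, ∫ U, outcomeDiff Λ Γ φ i (V, U) ^ 4 ∂ν ∂ν ≤
      101 * ∫ V, F V ^ 2 ∂ν := by
    rw [← integral_const_mul, ← integral_const_mul]
    exact integral_mono (i4.integral_prod_left.const_mul _) (iF2.const_mul _)
      fun V => (hU V).pow_four_le
  change |(d * (d + 1) : ℝ) * ∫ V, F V ∂ν - _| ≤ _ at m1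
  change (d : ℝ) ^ 4 * ∫ V, F V ^ 2 ∂ν ≤ _ at m2
  generalize (∫ V, ∫ U, outcomeDiff Λ Γ φ i (V, U) ^ 2 ∂ν ∂ν) = x2 at *
  generalize (∫ V, ∫ U, outcomeDiff Λ Γ φ i (V, U) ^ 4 ∂ν ∂ν) = x4 at *
  generalize (∫ V, F V ∂ν) = f1 at *
  generalize (∫ V, F V ^ 2 ∂ν) = f2 at *
  have hd2 : (0 : ℝ) < d ^ 2 := by positivity
  obtain ⟨m1a, m1b⟩ := abs_le.1 m1
  have hdd : (0 : ℝ) < d * (d + 1) := by positivity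
  have hD : 0 ≤ (d : ℝ) ^ 2 * D ^ 2 := by positivity
  -- The relative errors of the `U` and `V` averages multiply: `0.999² ≥ 0.99`, `1.001² ≤ 1.01`, and
  -- the fourth-moment constants give `101²`.
  refine ⟨?_, ?_, ?_⟩
  · have := mul_le_mul_of_nonneg_left a1 hdd.le
    refine le_of_mul_le_mul_left ?_ hd2
    nlinarith
  · have := mul_le_mul_of_nonneg_left a2 hdd.le
    refine le_of_mul_le_mul_left ?_ hd2
    nlinarith
  · have h4 : (0 : ℝ) < d ^ 4 := by positivity
    have := mul_le_mul_of_nonneg_left a4 h4.le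
    refine le_of_mul_le_mul_left ?_ h4
    nlinarith

lemma averageCaseDistance_nonneg {d : ℕ}
    (Λ Γ : Matrix (Fin d) (Fin d) ℂ →ₗ[ℂ] Matrix (Fin d) (Fin d) ℂ) :
    0 ≤ averageCaseDistance Λ Γ := by
  unfold averageCaseDistance
  positivity

/-- The expected absolute difference of the probabilities of an outcome. -/
lemma IsApproxDesign.integral_abs_outcomeDiff {d : ℕ} {δ : ℝ} (hδ : 0 ≤ δ)
    (hδd : δ * d ^ 8 ≤ 1 / 2304) {ν : Measure (Unitaries d)} [IsProbabilityMeasure ν]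
    (h : IsApproxDesign δ 4 ν)
    {Λ Γ : Matrix (Fin d) (Fin d) ℂ →ₗ[ℂ] Matrix (Fin d) (Fin d) ℂ} (hΛ : IsQuantumChannel Λ)
    (hΓ : IsQuantumChannel Γ) {φ : EuclideanSpace ℂ (Fin d)} (hφ : ‖φ‖ = 1) (i : Fin d) :
    averageCaseDistance Λ Γ / (1000 * d) ≤ ∫ W, |outcomeDiff Λ Γ φ i W| ∂(ν.prod ν) ∧
    ∫ W, |outcomeDiff Λ Γ φ i W| ∂(ν.prod ν) ≤ 2.02 * averageCaseDistance Λ Γ / d := by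
  have hd1 : (1 : ℝ) ≤ d := by exact_mod_cast i.pos
  have hd0 : (0 : ℝ) < d := by linarith
  obtain ⟨lo, up, four⟩ := h.moments_outcomeDiff hδ hδd hΛ hΓ hφ i
  have hx := continuous_outcomeDiff Λ Γ φ i
  have i1 : Integrable (outcomeDiff Λ Γ φ i) (ν.prod ν) := hx.integrable_of_compact _
  have i2 : Integrable (fun W => outcomeDiff Λ Γ φ i W ^ 2) (ν.prod ν) :=
    (hx.pow 2).integrable_of_compact _
  have i4 : Integrable (fun W => outcomeDiff Λ Γ φ i W ^ 4) (ν.prod ν) :=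
    (hx.pow 4).integrable_of_compact _
  have hD := averageCaseDistance_nonneg Λ Γ
  generalize averageCaseDistance Λ Γ = D at *
  constructor
  · rcases hD.eq_or_lt with h0 | h0
    · rw [← h0, zero_div]
      exact integral_nonneg fun W => abs_nonneg _
    -- Since `404² = 101² * 16` is the constant of the fourth moment, the two terms become `0.99 /
    -- 404` and `1 / 1616` times `D / d`; their difference exceeds `1 / 1000`.
    · have ht : 0 < 404 * D / d := by positivity
      refine le_trans ?_ (le_integral_abs_of_moments i1 i2 i4 ht)
      have b2 : 0.99 * D ^ 2 / d ^ 2 ≤ ∫ W, outcomeDiff Λ Γ φ i W ^ 2 ∂(ν.prod ν) := by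
        have hm : 0 ≤ ∫ W, outcomeDiff Λ Γ φ i W ^ 2 ∂(ν.prod ν) :=
          integral_nonneg fun W => by positivity
        rw [div_le_iff₀ (by positivity)]
        -- Replacing `d + 1` by `2 d` costs the factor four in the second moment.
        have : (d + 1 : ℝ) ^ 2 ≤ 4 * d ^ 2 := by nlinarith
        nlinarith [mul_le_mul_of_nonneg_right this hm]
      have b4 : ∫ W, outcomeDiff Λ Γ φ i W ^ 4 ∂(ν.prod ν) ≤ 101 ^ 2 * 16 * D ^ 4 / d ^ 4 := by
        rw [le_div_iff₀ (by positivity)]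
        linarith
      have c2 : 0.99 / 404 * (D / d) ≤
          (∫ W, outcomeDiff Λ Γ φ i W ^ 2 ∂(ν.prod ν)) / (404 * D / d) := by
        rw [le_div_iff₀ ht]
        refine le_trans (le_of_eq ?_) b2
        field_simp
      have c4 : (∫ W, outcomeDiff Λ Γ φ i W ^ 4 ∂(ν.prod ν)) / (4 * (404 * D / d) ^ 3) ≤
          1 / 1616 * (D / d) := by
        rw [div_le_iff₀ (by positivity)]
        refine b4.trans (le_of_eq ?_)
        field_simp
        norm_num
      have e : D / (1000 * d) = 1 / 1000 * (D / d) := by ring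
      have : 0 ≤ D / d := by positivity
      rw [e]
      linarith
  · have h1 := integral_abs_le_of_integral_sq_le i1 i2 (s := 2 * D / d) (c := 1.01)
      (by positivity) (by norm_num) ?_
    · refine h1.trans (le_of_eq ?_)
      ring
    · have hm : 0 ≤ ∫ W, outcomeDiff Λ Γ φ i W ^ 2 ∂(ν.prod ν) :=
        integral_nonneg fun W => by positivity
      rw [div_pow, ← mul_div_assoc, le_div_iff₀ (by positivity)]
      have : (d : ℝ) ^ 2 ≤ (d + 1) ^ 2 := by nlinarith
      nlinarith [mul_le_mul_of_nonneg_right this hm]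

theorem theorem3 :
    ∃ ε : ℝ, 0 ≤ ε ∧ ε < 1 ∧
      ∀ (d : ℕ) (Λ Γ : Matrix (Fin d) (Fin d) ℂ →ₗ[ℂ] Matrix (Fin d) (Fin d) ℂ),
        IsQuantumChannel Λ → IsQuantumChannel Γ →
        ∀ (δ' : ℝ), 0 < δ' → δ' < 1 / 9 →
        ∀ (ν : Measure (Unitaries d)) [IsProbabilityMeasure ν],
          IsApproxDesign (δ' / (2 * (d : ℝ)) ^ 8) 4 ν →
          ∀ φ : EuclideanSpace ℂ (Fin d), ‖φ‖ = 1 →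
            |averageTV ν φ Λ Γ - averageCaseDistance Λ Γ| ≤ ε * averageCaseDistance Λ Γ := by
  -- Half the sum over `d` outcomes lies between `D / 2000` and `1.01 D`, so the lower bound
  -- dictates the constant.
  refine ⟨1999 / 2000, by norm_num, by norm_num, ?_⟩
  intro d Λ Γ hΛ hΓ δ' hδ0 hδ1 ν _ hν φ hφ
  have hd : 0 < d := by
    rcases Nat.eq_zero_or_pos d with rfl | hd
    · have := sum_normSq_eq_one hφ
      simp at this
    · exact hd
  have hd0 : (0 : ℝ) < d := by exact_mod_cast hd
  have hδ : 0 ≤ δ' / (2 * (d : ℝ)) ^ 8 := by positivity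
  -- `2304 = 9 * 2 ^ 8`, from `δ' < 1 / 9`.
  have hδd : δ' / (2 * (d : ℝ)) ^ 8 * d ^ 8 ≤ 1 / 2304 := by
    have e : δ' / (2 * (d : ℝ)) ^ 8 * d ^ 8 = δ' / 256 := by
      field_simp
      norm_num
    rw [e]
    linarith
  have key := hν.integral_abs_outcomeDiff hδ hδd hΛ hΓ hφ
  have hD := averageCaseDistance_nonneg Λ Γ
  have lo := Finset.card_nsmul_le_sum Finset.univ _ _ fun i _ => (key i).1
  have up := Finset.sum_le_card_nsmul Finset.univ _ _ fun i _ => (key i).2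
  rw [Finset.card_univ, Fintype.card_fin, nsmul_eq_mul] at lo up
  have e1 : (d : ℝ) * (averageCaseDistance Λ Γ / (1000 * d)) = averageCaseDistance Λ Γ / 1000 := by
    field_simp
  have e2 : (d : ℝ) * (2.02 * averageCaseDistance Λ Γ / d) = 2.02 * averageCaseDistance Λ Γ := by
    field_simp
  rw [e1] at lo
  rw [e2] at up
  rw [averageTV_eq, abs_le]
  constructor <;> linarith
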